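/- Power counting for the $U(1)^4$ tensor model. Fix $M>1$, $m>0$, $B\in\mathbb R$. For angles $\theta,\theta'\in(\mathbb R/2\pi\mathbb Z)^4$ let $$C_i(\theta;\theta')=\pi^2\int_{I_i}\frac{e^{-m^2\alpha}}{\alpha^2}\,e^{-\frac1{4\alpha}\sum_{s=1}^4(\theta_s-\theta'_s)^2}\prod_{s=1}^4\Big\{1+2\sum_{n\ge1}e^{-\pi^2n^2/\alpha}\cosh\Big[\frac{n\pi}{\alpha}(\theta_s-\theta'_s)\Big]\Big\}\,d\alpha ,$$ with $I_0=(M^{-2},\infty)$ and $I_i=(M^{-2(i+1)},M^{-2i}]$ for $i\ge1$, so that $\sum_{i\ge0}C_i=C$ is the kernel of $(-\sum_s\Delta_s+m^2)^{-1}$ with respect to normalized Haar measure. Graphs. The vertices of a graph are the terms of the following interactions (subscripts denote the group variables, equal subscripts are identified): $S_{6;1}=\int\varphi_{1,2,3,4}\bar\varphi_{1',2,3,4}\varphi_{1',2',3',4'}\bar\varphi_{1'',2',3',4'}\varphi_{1'',2'',3'',4''}\bar\varphi_{1,2'',3'',4''}$, $S_{6;2}=\int\varphi_{1,2,3,4}\bar\varphi_{1',2',3',4}\varphi_{1',2',3',4'}\bar\varphi_{1'',2,3,4'}\varphi_{1'',2'',3'',4''}\bar\varphi_{1,2'',3'',4''}$,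 $S_{4;1}=\int\varphi_{1,2,3,4}\bar\varphi_{1',2,3,4}\varphi_{1',2',3',4'}\bar\varphi_{1,2',3',4'}$, each with all permutations of the four argument places; $S_{4;2}=(\int\bar\varphi\varphi)^2$; the mass vertex $S_{2;1}=\int\bar\varphi\varphi$; and the wave function vertex $S_{2;2}=\int\bar\varphi(-\sum_s\Delta_s)\varphi$. A graph $\mathcal G$ consists of finitely many vertices and finitely many lines, each line contracting a field $\varphi$ with a field $\bar\varphi$, no field being contracted twice; the uncontracted fields are the external legs. A scale attribution $\mu$ assigns to each line $\ell$ an integer scale $i_\ell\in[0,\Lambda]$. The amputated amplitude $A_{\mathcal G;\mu}$ is the integral, over all vertex angles with respect to normalized Haar measure (angles being identified as prescribed by the vertices), of the product of the propagators $C_{i_\ell}$ of the lines and of one smooth test function on the torus for each external leg; at a wave function vertex, $-\sum_s\Delta_s$ acts on the propagator or test function attached to the field $\varphi$ of that vertex. Subgraphs. For $i\ge0$ let $G_i^{(k)}$, $k=1,2,\dots$, be the connected components of the subgraph made of the lines of scale at least $i$ (each component has at least one line). For a subgraph $H$ given by its lines, let $L(H)$ be the number of its lines, $V_2'(H)$ the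 number of wave function vertices touched by its lines, $F_{\rm int}(H)$ the number of closed faces (closed circuits of strands) all of whose lines are in $H$, and $$\omega_d(H)=-2L(H)+F_{\rm int}(H)+2V_2'(H).$$ Claim. There is a constant $K>0$, depending only on $M$, $m$ and $B$, such that for every connected graph $\mathcal G$ with $n$ vertices, every $\Lambda$, every scale attribution $\mu$, and all smooth test functions $f$ on the external legs with $|f|\le B$ and $|\sum_s\Delta_sf|\le B$, the integrand of $A_{\mathcal G;\mu}$ is integrable and $$|A_{\mathcal G;\mu}|\le K^{n}\prod_{(i,k)}M^{\omega_d(G_i^{(k)})},$$ where the product is over all $0\le i\le\Lambda$ and all components $G_i^{(k)}$. -/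

import Mathlib

open scoped ContDiff

namespace TensorField

noncomputable section

/-! ## Sliced propagator on the torus `U(1)^4` (angles are real numbers modulo `2π`) -/

/-- The one-strand theta factor `1 + 2 ∑_{n ≥ 1} exp (-π² n² / α) cosh (n π t / α)`. -/
def thetaFactor (α t : ℝ) : ℝ :=
  1 + 2 * ∑' n : ℕ, Real.exp (-(Real.pi ^ 2 * ((n : ℝ) + 1) ^ 2) / α)
    * Real.cosh (((n : ℝ) + 1) * Real.pi / α * t)

/-- The range of the Schwinger parameter `α` in slice `i`: `(M^{-2}, ∞)` for the last slice
`i = 0`, and `(M^{-2(i+1)}, M^{-2i}]` for `i ≥ 1`. -/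
def slice (M : ℝ) : ℕ → Set ℝ
  | 0 => Set.Ioi ((M ^ 2)⁻¹)
  | i + 1 => Set.Ioc ((M ^ (2 * (i + 2)))⁻¹) ((M ^ (2 * (i + 1)))⁻¹)

/-- The sliced propagator `C_i` of `(-∑_s Δ_s + m²)⁻¹`, a kernel with respect to the normalized
Haar measure of the torus. As a function of the real angles it is `2π`-periodic. -/
def sliceKernel (M m : ℝ) (i : ℕ) (x y : Fin 4 → ℝ) : ℝ :=
  Real.pi ^ 2 * ∫ α in slice M i,
    Real.exp (-m ^ 2 * α) / α ^ 2
      * Real.exp (-(1 / (4 * α)) * ∑ s, (x s - y s) ^ 2)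
      * ∏ s, thetaFactor α (x s - y s)

/-- The Laplacian `∑_s ∂_s²` on the four angles. -/
def laplacian (F : (Fin 4 → ℝ) → ℂ) (x : Fin 4 → ℝ) : ℂ :=
  ∑ s : Fin 4, iteratedDeriv 2 (fun t : ℝ => F (Function.update x s t)) (x s)

/-- Smooth functions on the torus, as smooth functions of four real angles that are
`2π`-periodic in each of them. -/
structure TestFunction where
  toFun : (Fin 4 → ℝ) → ℂ
  smooth : ContDiff ℝ ∞ toFun
  periodic : ∀ (x : Fin 4 → ℝ) (s : Fin 4),
    toFun (Function.update x s (x s + 2 * Real.pi)) = toFun x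

/-- The function and its Laplacian are bounded by `B`. -/
def TestFunction.BoundedBy (f : TestFunction) (B : ℝ) : Prop :=
  ∀ x, ‖f.toFun x‖ ≤ B ∧ ‖laplacian f.toFun x‖ ≤ B

/-- The normalized Haar measure `dθ / 2π` of `U(1)`, on the angles `(0, 2π]`. -/
def haarAngle : MeasureTheory.Measure ℝ :=
  (ENNReal.ofReal (2 * Real.pi))⁻¹ •
    MeasureTheory.volume.restrict (Set.Ioc 0 (2 * Real.pi))

/-! ## Interaction vertices -/

/-- The vertices of the model: the terms of `S_{6;1}`, `S_{6;2}`, `S_{4;1}` (one for each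
permutation of the four colours), `S_{4;2} = (∫ φ̄ φ)²`, the mass vertex `S_{2;1} = ∫ φ̄ φ` and the
wave function vertex `S_{2;2} = ∫ φ̄ (-∑_s Δ_s) φ`. -/
inductive VertexKind where
  | six1 (π : Equiv.Perm (Fin 4))
  | six2 (π : Equiv.Perm (Fin 4))
  | four1 (π : Equiv.Perm (Fin 4))
  | four2
  | mass
  | wave

/-- The number of fields `φ` in the vertex; the number of fields `φ̄` is the same. -/
def VertexKind.order : VertexKind → ℕ
  | .six1 _ => 3
  | .six2 _ => 3
  | .four1 _ => 2
  | .four2 => 2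
  | .mass => 1
  | .wave => 1

/-- The strand structure of a vertex: in strand `s`, the argument of the `a`-th field `φ` is
identified with the argument of the `(pairing s a)`-th field `φ̄`. The fields of each kind are
numbered in the order in which they appear in
* `φ_{1,2,3,4} φ̄_{1',2,3,4} φ_{1',2',3',4'} φ̄_{1'',2',3',4'} φ_{1'',2'',3'',4''} φ̄_{1,2'',3'',4''}`,
* `φ_{1,2,3,4} φ̄_{1',2',3',4} φ_{1',2',3',4'} φ̄_{1'',2,3,4'} φ_{1'',2'',3'',4''} φ̄_{1,2'',3'',4''}`,
* `φ_{1,2,3,4} φ̄_{1',2,3,4} φ_{1',2',3',4'} φ̄_{1,2',3',4'}`,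

and the permutation permutes the four argument places. -/
def VertexKind.pairing : (k : VertexKind) → Fin 4 → Equiv.Perm (Fin k.order)
  | .six1 π, s => if s = π 0 then (finRotate 3)⁻¹ else 1
  | .six2 π, s => if s = π 0 then (finRotate 3)⁻¹ else if s = π 3 then 1
      else (Equiv.swap 0 1 : Equiv.Perm (Fin 3))
  | .four1 π, s => if s = π 0 then (Equiv.swap 0 1 : Equiv.Perm (Fin 2)) else 1
  | .four2, _ => 1
  | .mass, _ => 1
  | .wave, _ => 1

/-! ## Feynman graphs -/

/-- An amputated Feynman graph: finitely many vertices, and finitely many (internal) lines, each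
of which contracts one field `φ` with one field `φ̄`, no field being contracted twice. The fields
that are not contracted are the external legs. -/
structure FeynmanGraph where
  V : Type
  [fintypeV : Fintype V]
  kind : V → VertexKind
  Line : Type
  [fintypeLine : Fintype Line]
  phiEnd : Line ↪ (Σ v : V, Fin (kind v).order)
  phibarEnd : Line ↪ (Σ v : V, Fin (kind v).order)

attribute [instance] FeynmanGraph.fintypeV FeynmanGraph.fintypeLine

namespace FeynmanGraph

variable (G : FeynmanGraph)

/-- The fields `φ` of the graph; it also indexes the fields `φ̄`. -/
abbrev Field : Type := Σ v : G.V, Fin (G.kind v).order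

/-- The external legs of type `φ`. -/
abbrev ExtPhi : Type := {a : G.Field // a ∉ Set.range G.phiEnd}

/-- The external legs of type `φ̄`. -/
abbrev ExtPhibar : Type := {b : G.Field // b ∉ Set.range G.phibarEnd}

/-- The field `φ̄` to which a field `φ` is joined in strand `s` by its vertex. -/
def partner (s : Fin 4) : Equiv.Perm G.Field :=
  Equiv.sigmaCongrRight fun v => (G.kind v).pairing s

/-- The vertex `v` is an end of the line `l`. -/
def Incident (l : G.Line) (v : G.V) : Prop :=
  (G.phiEnd l).1 = v ∨ (G.phibarEnd l).1 = v

/-- Two different vertices are adjacent if some line joins them. -/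
def vertexGraph : SimpleGraph G.V :=
  SimpleGraph.fromRel fun v w => ∃ l, G.Incident l v ∧ G.Incident l w

/-- Connected graphs (with at least one vertex). -/
def IsConnected : Prop := G.vertexGraph.Connected

/-! ### Faces and degree of divergence -/

/-- A strand of a line: `(l, s)` is the strand of colour `s` of the line `l`. -/
abbrev Strand : Type := G.Line × Fin 4

/-- The strand `y` follows `x`: the vertex at the `φ`-end of `x` joins it to the `φ̄`-end
of `y`. -/
def Follows (x y : G.Strand) : Prop :=
  x.2 = y.2 ∧ G.partner x.2 (G.phiEnd x.1) = G.phibarEnd y.1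

/-- The face that contains a given strand. -/
def faceOf (x : G.Strand) : Set G.Strand := {y | Relation.EqvGen G.Follows x y}

/-- The closed (internal) faces: those in which every strand is followed by another one, so that
the strands form a closed circuit. -/
def internalFaces : Set (Set G.Strand) :=
  {f | (∃ x, f = G.faceOf x) ∧ ∀ x ∈ f, ∃ y, G.Follows x y}

/-- `L(H)`, for the subgraph with set of lines `H`. -/
def numLines (H : Set G.Line) : ℕ := H.ncard

/-- `F_int(H)`: the closed faces of which all lines belong to `H`. -/
def numInternalFaces (H : Set G.Line) : ℕ :=
  {f | f ∈ G.internalFaces ∧ ∀ x ∈ f, x.1 ∈ H}.ncard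

/-- `V'_2(H)`: the wave function vertices of the subgraph with set of lines `H`. -/
def numWave (H : Set G.Line) : ℕ :=
  {v | G.kind v = VertexKind.wave ∧ ∃ l ∈ H, G.Incident l v}.ncard

/-- `ω_d = -2 L + F_int + 2 V'_2`. -/
def omegaD (H : Set G.Line) : ℤ :=
  -2 * (G.numLines H : ℤ) + (G.numInternalFaces H : ℤ) + 2 * (G.numWave H : ℤ)

/-! ### High subgraphs -/

variable {G}

/-- The lines of scale at least `i`, two of them being adjacent if they share a vertex. -/
def highGraph (μ : G.Line → ℕ) (i : ℕ) : SimpleGraph {l : G.Line // i ≤ μ l} :=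
  SimpleGraph.fromRel fun l l' => ∃ v, G.Incident l.1 v ∧ G.Incident l'.1 v

/-- The index set of `k` for the connected components `G_i^k` of the subgraph made of the lines
of scale at least `i`. -/
abbrev HighComponent (μ : G.Line → ℕ) (i : ℕ) : Type := (highGraph μ i).ConnectedComponent

instance instFintypeHighComponent (μ : G.Line → ℕ) (i : ℕ) : Fintype (HighComponent μ i) :=
  Fintype.ofFinite _

/-- The set of lines of `G_i^k`. -/
def componentLines {μ : G.Line → ℕ} {i : ℕ} (k : HighComponent μ i) : Set G.Line :=
  Subtype.val '' k.supp

/-! ### Amplitude -/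

variable (G)

/-- One angle for each strand of each field `φ`. The delta functions of the vertices identify it
with an angle of a field `φ̄`, so that these are all the integration variables. -/
abbrev Angles : Type := G.Field × Fin 4 → ℝ

variable {G}

/-- The four arguments of the field `φ` number `a`. -/
def argPhi (θ : G.Angles) (a : G.Field) : Fin 4 → ℝ := fun s => θ (a, s)

/-- The four arguments of the field `φ̄` number `b`. -/
def argPhibar (θ : G.Angles) (b : G.Field) : Fin 4 → ℝ := fun s => θ ((G.partner s).symm b, s)

/-- At a wave function vertex the function contracted with the field `φ` is differentiated
by `-∑_s Δ_s`; at the other vertices nothing happens. -/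
def dress (a : G.Field) (F : (Fin 4 → ℝ) → ℂ) : (Fin 4 → ℝ) → ℂ :=
  match G.kind a.1 with
  | .wave => fun x => -laplacian F x
  | _ => F

/-- The propagator of a line in the slice given by the scale attribution `μ`. -/
def lineFactor (M m : ℝ) (μ : G.Line → ℕ) (θ : G.Angles) (l : G.Line) : ℂ :=
  dress (G.phiEnd l)
    (fun x => ((sliceKernel M m (μ l) x (argPhibar θ (G.phibarEnd l)) : ℝ) : ℂ))
    (argPhi θ (G.phiEnd l))

open Classical in
/-- The integrand of the amplitude: sliced propagators on the lines and test functions on the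
external legs. -/
def integrand (M m : ℝ) (μ : G.Line → ℕ) (f : G.ExtPhi → TestFunction)
    (fbar : G.ExtPhibar → TestFunction) (θ : G.Angles) : ℂ :=
  (∏ l : G.Line, lineFactor M m μ θ l)
    * (∏ a : G.ExtPhi, dress a.1 (f a).toFun (argPhi θ a.1))
    * ∏ b : G.ExtPhibar, (fbar b).toFun (argPhibar θ b.1)

variable (G) in
/-- Normalized Haar measure on all the angles. -/
def haarAngles : MeasureTheory.Measure G.Angles :=
  MeasureTheory.Measure.pi fun _ => haarAngle

/-- The amplitude `A_{G;μ}`, with the external arguments integrated against test functions. -/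
def amplitude (M m : ℝ) (μ : G.Line → ℕ) (f : G.ExtPhi → TestFunction)
    (fbar : G.ExtPhibar → TestFunction) : ℂ :=
  ∫ θ, integrand M m μ f fbar θ ∂G.haarAngles

end FeynmanGraph

end

end TensorField

namespace TensorField

/-! ## Periodised Gaussians -/

/-! The amplitude is estimated strand by strand. A propagator of scale `i` is at most a constant
times `M^(2i)`, or `M^(4i)` if a Laplacian acts on it, times a product over the four colours of
periodised Gaussians of width about `M^(-i)` (`exists_kern_bound`). Each such Gaussian is bounded by
a constant, and its integral over one normalized angle is at most `M^(-i)`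
(`lintegral_strandBound_le`).

Regard the strands as edges between angles. No field is contracted twice, so each angle is the head
of at most one strand and the tail of at most one: the edges form paths and circuits, and the
circuits are the closed faces. In each closed face one strand of minimal scale is bounded pointwise.
The other strands form a forest and are integrated one angle at a time (`exists_terminal`,
`lintegral_prod_forest_le`). Up to a factor `K^n` this leaves `M` to the power `2 Σ μ_l + 2 Σ_wave
μ_l - 4 Σ μ_l + Σ_f min_f μ`, where `Σ_wave` runs over the lines whose `φ`-end is at a wave function
vertex.

This exponent is compared with the sum of all `ω_d` by counting levels `i` (`le_sum_omegaD`): a line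
is in a high subgraph at `μ_l + 1` levels, a closed face at `min_f μ + 1` levels, and a wave
function vertex is touched at `μ_l + 1` levels or more if `l` contracts its `φ`. The discrepancy is
at most twice the number of lines, hence at most `6n`. -/

/-- The Gaussian `exp (-u² / 4α)` and its first two derivatives in `u`. -/
noncomputable def thetaTerm : ℕ → ℝ → ℝ → ℝ
  | 0, α, u => Real.exp (-u ^ 2 / (4 * α))
  | 1, α, u => -(u / (2 * α)) * Real.exp (-u ^ 2 / (4 * α))
  | _ + 2, α, u => (u ^ 2 / (4 * α ^ 2) - 1 / (2 * α)) * Real.exp (-u ^ 2 / (4 * α))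

/-- The constants that compare `thetaTerm j α` with the Gaussian of parameter `2 α`. -/
noncomputable def thetaWeight : ℕ → ℝ → ℝ
  | 0, _ => 1
  | 1, α => 1 + 1 / (4 * α)
  | _ + 2, α => 2 / α

/-- The periodised Gaussian and its first two derivatives. -/
noncomputable def thetaSum (j : ℕ) (α t : ℝ) : ℝ :=
  ∑' n : ℤ, thetaTerm j α (t + 2 * Real.pi * n)

lemma thetaTerm_zero_pos (α u : ℝ) : 0 < thetaTerm 0 α u := by
  unfold thetaTerm; positivity

lemma thetaWeight_nonneg (j : ℕ) {α : ℝ} (hα : 0 < α) : 0 ≤ thetaWeight j α := by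
  rcases j with _ | _ | j <;> simp only [thetaWeight] <;> positivity

/-- With `x = u² / 8α` this is `2x ≤ e^x`, which follows from `e^x ≥ (1 + x/2)²` and `(1 + x/2)² -
2x = (x/2 - 1)²`. -/
lemma sq_div_mul_exp_le {α : ℝ} (hα : 0 < α) (u : ℝ) :
    u ^ 2 / (4 * α) * Real.exp (-u ^ 2 / (4 * α)) ≤ Real.exp (-u ^ 2 / (4 * (2 * α))) := by
  set x := u ^ 2 / (8 * α) with hx
  have h1 : u ^ 2 / (4 * α) = 2 * x := by rw [hx]; field_simp; ring
  have h2 : -u ^ 2 / (4 * α) = -x + -x := by rw [hx]; field_simp; ring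
  have h3 : -u ^ 2 / (4 * (2 * α)) = -x := by rw [hx]; field_simp; ring
  rw [h1, h2, h3, Real.exp_add]
  have h6 : 2 * x ≤ Real.exp x := by
    have h7 : Real.exp x = Real.exp (x / 2) ^ 2 := by
      rw [← Real.exp_nat_mul]; congr 1; push_cast; ring
    have hx0 : 0 ≤ x := by positivity
    have h8 : 1 + x / 2 ≤ Real.exp (x / 2) := by linarith [Real.add_one_le_exp (x / 2)]
    rw [h7]
    nlinarith [sq_nonneg (x / 2 - 1), mul_self_le_mul_self (by positivity) h8]
  have h9 : 2 * x * Real.exp (-x) ≤ 1 := by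
    calc 2 * x * Real.exp (-x) ≤ Real.exp x * Real.exp (-x) := by gcongr
      _ = 1 := by rw [← Real.exp_add]; simp
  nlinarith [Real.exp_pos (-x)]

lemma thetaTerm_zero_mono {α β : ℝ} (hα : 0 < α) (h : α ≤ β) (u : ℝ) :
    thetaTerm 0 α u ≤ thetaTerm 0 β u := by
  simp only [thetaTerm, neg_div]
  gcongr

/-- Doubling `α` gives up half of the Gaussian decay, which absorbs the polynomial prefactors. The
weight for `j = 1` is crude, but first derivatives only serve to differentiate under the integral;
the order `1/α` for `j = 2` enters the power counting. -/
lemma abs_thetaTerm_le (j : ℕ) {α : ℝ} (hα : 0 < α) (u : ℝ) :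
    |thetaTerm j α u| ≤ thetaWeight j α * thetaTerm 0 (2 * α) u := by
  have hm := thetaTerm_zero_mono hα (by linarith : α ≤ 2 * α) u
  have hs := sq_div_mul_exp_le hα u
  have hp := thetaTerm_zero_pos α u
  rcases j with _ | _ | j
  · rw [abs_of_pos hp]; simpa [thetaWeight] using hm
  · simp only [thetaTerm, thetaWeight] at *
    set E := Real.exp (-u ^ 2 / (4 * α))
    set E2 := Real.exp (-u ^ 2 / (4 * (2 * α)))
    rw [abs_mul, abs_of_pos hp, abs_neg, abs_div, abs_of_pos (by linarith : 0 < 2 * α)]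
    have h1 : |u| / (2 * α) ≤ 1 / (4 * α) + u ^ 2 / (4 * α) := by
      rw [← add_div, div_le_div_iff₀ (by positivity) (by positivity)]
      nlinarith [sq_nonneg (|u| - 1), sq_abs u]
    calc |u| / (2 * α) * E ≤ (1 / (4 * α) + u ^ 2 / (4 * α)) * E := by gcongr
      _ = 1 / (4 * α) * E + u ^ 2 / (4 * α) * E := by ring
      _ ≤ 1 / (4 * α) * E2 + E2 := by gcongr
      _ = _ := by ring
  · simp only [thetaTerm, thetaWeight] at *
    set E := Real.exp (-u ^ 2 / (4 * α))
    set E2 := Real.exp (-u ^ 2 / (4 * (2 * α)))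
    rw [abs_mul, abs_of_pos hp]
    have h1 : |u ^ 2 / (4 * α ^ 2) - 1 / (2 * α)| ≤ u ^ 2 / (4 * α ^ 2) + 1 / (2 * α) := by
      refine (abs_sub _ _).trans ?_
      rw [abs_of_nonneg (by positivity), abs_of_nonneg (by positivity)]
    calc _ ≤ (u ^ 2 / (4 * α ^ 2) + 1 / (2 * α)) * E := by gcongr
      _ = 1 / α * (u ^ 2 / (4 * α) * E) + 1 / (2 * α) * E := by field_simp
      _ ≤ 1 / α * E2 + 1 / α * E2 := by gcongr; linarith
      _ = _ := by ring

/-- The range stops at `j = 1` because `thetaTerm` repeats the second derivative for all larger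
orders. -/
lemma hasDerivAt_thetaTerm {j : ℕ} (hj : j ≤ 1) {α : ℝ} (hα : 0 < α) (u : ℝ) :
    HasDerivAt (thetaTerm j α) (thetaTerm (j + 1) α u) u := by
  have hE : HasDerivAt (fun u : ℝ => Real.exp (-u ^ 2 / (4 * α)))
      (-(u / (2 * α)) * Real.exp (-u ^ 2 / (4 * α))) u := by
    have := (((hasDerivAt_id u).pow 2).neg.div_const (4 * α)).exp
    refine this.congr_deriv ?_
    simp only [Pi.neg_apply, Pi.pow_apply, id]
    field_simp
    push_cast
    ring
  interval_cases j
  · exact hE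
  · have h1 : HasDerivAt (fun u : ℝ => -(u / (2 * α))) (-(1 / (2 * α))) u :=
      ((hasDerivAt_id u).div_const (2 * α)).neg
    refine (h1.mul hE).congr_deriv ?_
    change _ = (u ^ 2 / (4 * α ^ 2) - 1 / (2 * α)) * Real.exp (-u ^ 2 / (4 * α))
    field_simp
    ring

lemma summable_inv_one_add_int_sq : Summable fun n : ℤ => (1 + (n : ℝ) ^ 2)⁻¹ := by
  have h := (Real.summable_one_div_int_pow (p := 2)).2 (by norm_num)
  refine Summable.of_norm_bounded_eventually h ?_
  filter_upwards [(Set.finite_singleton (0 : ℤ)).compl_mem_cofinite] with n hn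
  have : (0 : ℝ) < (n : ℝ) ^ 2 := by
    have : (n : ℝ) ≠ 0 := by simpa using hn
    positivity
  rw [Real.norm_of_nonneg (by positivity), one_div]
  gcongr
  linarith

/-- From `e^(-x) ≤ 1/(1 + x)` and `n² ≤ (2πn)² ≤ 2u² + 2t²`. Uniformity in `|t| ≤ R` permits
termwise differentiation, and linearity in `α` gives the growth rate of the theta sums. -/
lemma thetaTerm_zero_le {α R t : ℝ} (hα : 0 < α) (ht : |t| ≤ R) (n : ℤ) :
    thetaTerm 0 α (t + 2 * Real.pi * n) ≤ (8 * α + 1 + 2 * R ^ 2) * (1 + (n : ℝ) ^ 2)⁻¹ := by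
  set u := t + 2 * Real.pi * n with hu
  have h1 : thetaTerm 0 α u ≤ 4 * α / (4 * α + u ^ 2) := by
    simp only [thetaTerm, neg_div, Real.exp_neg]
    rw [← inv_div (4 * α + u ^ 2)]
    have : (4 * α + u ^ 2) / (4 * α) = u ^ 2 / (4 * α) + 1 := by field_simp; ring
    rw [this]
    gcongr
    exact Real.add_one_le_exp _
  have hn : (n : ℝ) ^ 2 ≤ 2 * u ^ 2 + 2 * R ^ 2 := by
    have hR : t ^ 2 ≤ R ^ 2 := sq_le_sq' (by linarith [neg_abs_le t]) (by linarith [le_abs_self t])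
    have h2 : (2 * Real.pi * n) ^ 2 ≤ 2 * u ^ 2 + 2 * t ^ 2 := by
      have : 2 * Real.pi * n = u - t := by rw [hu]; ring
      rw [this]; nlinarith [sq_nonneg (u + t)]
    have h3 : (n : ℝ) ^ 2 ≤ (2 * Real.pi * n) ^ 2 := by
      have : (1 : ℝ) ≤ (2 * Real.pi) ^ 2 := by nlinarith [Real.pi_gt_three]
      calc (n : ℝ) ^ 2 = 1 * (n : ℝ) ^ 2 := by ring
        _ ≤ (2 * Real.pi) ^ 2 * (n : ℝ) ^ 2 := by gcongr
        _ = _ := by ring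
    linarith
  refine h1.trans ?_
  rw [← div_eq_mul_inv, div_le_div_iff₀ (by positivity) (by positivity)]
  nlinarith [sq_nonneg u, sq_nonneg R, mul_nonneg (sq_nonneg u) (sq_nonneg R),
    mul_le_mul_of_nonneg_left hn hα.le, mul_nonneg hα.le (sq_nonneg R)]

lemma abs_thetaTerm_le_inv (j : ℕ) {α R t : ℝ} (hα : 0 < α) (ht : |t| ≤ R) (n : ℤ) :
    |thetaTerm j α (t + 2 * Real.pi * n)| ≤
      thetaWeight j α * ((16 * α + 1 + 2 * R ^ 2) * (1 + (n : ℝ) ^ 2)⁻¹) := by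
  refine (abs_thetaTerm_le j hα _).trans ?_
  have := thetaTerm_zero_le (by linarith : 0 < 2 * α) ht n
  have h2 := thetaWeight_nonneg j hα
  gcongr
  linarith

lemma summable_thetaTerm (j : ℕ) {α : ℝ} (hα : 0 < α) (t : ℝ) :
    Summable fun n : ℤ => thetaTerm j α (t + 2 * Real.pi * n) :=
  Summable.of_norm_bounded
    ((summable_inv_one_add_int_sq.mul_left (16 * α + 1 + 2 * |t| ^ 2)).mul_left (thetaWeight j α))
    fun n => abs_thetaTerm_le_inv j hα le_rfl n

lemma hasDerivAt_thetaSum {j : ℕ} (hj : j ≤ 1) {α : ℝ} (hα : 0 < α) (t : ℝ) :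
    HasDerivAt (thetaSum j α) (thetaSum (j + 1) α t) t := by
  have hu := (summable_inv_one_add_int_sq.mul_left
    (16 * α + 1 + 2 * (|t| + 1) ^ 2)).mul_left (thetaWeight (j + 1) α)
  have ht : t ∈ Metric.ball (0 : ℝ) (|t| + 1) := by simp
  refine hasDerivAt_tsum_of_isPreconnected (t := Metric.ball (0 : ℝ) (|t| + 1)) hu
    Metric.isOpen_ball (convex_ball _ _).isPreconnected
    (g := fun (n : ℤ) y => thetaTerm j α (y + 2 * Real.pi * n))
    (g' := fun (n : ℤ) y => thetaTerm (j + 1) α (y + 2 * Real.pi * n))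
    (fun n y _ => ?_) (fun n y hy => ?_) ht (summable_thetaTerm j hα t) ht
  · exact (hasDerivAt_thetaTerm hj hα _).comp_add_const y _
  · refine abs_thetaTerm_le_inv (j + 1) hα ?_ n
    have := mem_ball_zero_iff.1 hy
    exact this.le

lemma thetaSum_zero_nonneg (α t : ℝ) : 0 ≤ thetaSum 0 α t :=
  tsum_nonneg fun _ => (thetaTerm_zero_pos _ _).le

lemma thetaSum_zero_mono {α β : ℝ} (hα : 0 < α) (h : α ≤ β) (t : ℝ) :
    thetaSum 0 α t ≤ thetaSum 0 β t :=
  (summable_thetaTerm 0 hα t).tsum_le_tsum (fun _ => thetaTerm_zero_mono hα h _)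
    (summable_thetaTerm 0 (hα.trans_le h) t)

lemma abs_thetaSum_le (j : ℕ) {α : ℝ} (hα : 0 < α) (t : ℝ) :
    |thetaSum j α t| ≤ thetaWeight j α * thetaSum 0 (2 * α) t := by
  have h := summable_thetaTerm 0 (by linarith : 0 < 2 * α) t
  unfold thetaSum
  rw [← tsum_mul_left]
  exact tsum_of_norm_bounded (h.mul_left _).hasSum fun n => by
    rw [Real.norm_eq_abs]
    exact abs_thetaTerm_le j hα _

lemma thetaSum_add_int (j : ℕ) (α t : ℝ) (k : ℤ) :
    thetaSum j α (t + 2 * Real.pi * k) = thetaSum j α t := by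
  unfold thetaSum
  rw [← (Equiv.addRight (-k)).tsum_eq]
  congr 1; ext n
  simp only [Equiv.coe_addRight, Int.cast_add, Int.cast_neg]
  congr 1; ring

/-- A uniform bound for the periodised Gaussians. -/
noncomputable def thetaConst : ℝ := (1 + 2 * Real.pi ^ 2) * ∑' n : ℤ, (1 + (n : ℝ) ^ 2)⁻¹

lemma one_le_thetaConst : 1 ≤ thetaConst := by
  have h : (1 : ℝ) ≤ ∑' n : ℤ, (1 + (n : ℝ) ^ 2)⁻¹ := by
    have := summable_inv_one_add_int_sq.le_tsum 0 (fun n _ => by positivity)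
    simpa using this
  unfold thetaConst
  nlinarith [sq_nonneg Real.pi]

/-- By periodicity `t` may be moved into `(-π, π]`, so the termwise bound applies with `R = π`.
Growth in `α` is harmless: the mass term compensates it in slice `0`. -/
lemma thetaSum_zero_le {α : ℝ} (hα : 0 < α) (t : ℝ) : thetaSum 0 α t ≤ thetaConst * (1 + α) := by
  obtain ⟨k, hk, -⟩ := existsUnique_add_zsmul_mem_Ioc Real.two_pi_pos t (-Real.pi)
  have hk' : |t + 2 * Real.pi * k| ≤ Real.pi := by
    rw [zsmul_eq_mul, mul_comm (k : ℝ)] at hk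
    exact abs_le.2 ⟨hk.1.le, by linarith [hk.2]⟩
  rw [← thetaSum_add_int 0 α t k]
  set t' := t + 2 * Real.pi * k
  have h := (summable_thetaTerm 0 hα t').tsum_le_tsum (fun n => thetaTerm_zero_le hα hk' n)
    (summable_inv_one_add_int_sq.mul_left _)
  rw [tsum_mul_left] at h
  refine h.trans ?_
  unfold thetaConst
  have hS : 0 ≤ ∑' n : ℤ, (1 + (n : ℝ) ^ 2)⁻¹ := tsum_nonneg fun n => by positivity
  have : 8 * α + 1 + 2 * Real.pi ^ 2 ≤ (1 + 2 * Real.pi ^ 2) * (1 + α) := by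
    nlinarith [Real.pi_gt_three, mul_pos hα hα, mul_le_mul_of_nonneg_left
      (show (9 : ℝ) ≤ Real.pi ^ 2 by nlinarith [Real.pi_gt_three]) hα.le]
  calc _ ≤ (1 + 2 * Real.pi ^ 2) * (1 + α) * ∑' n : ℤ, (1 + (n : ℝ) ^ 2)⁻¹ := by gcongr
    _ = _ := by ring

/-- Expanding `(t + 2πk)² / 4α` separates `t² / 4α`, `πkt / α` and `π²k² / α`; the terms `k = ±(n +
1)` combine into a hyperbolic cosine. -/
lemma exp_mul_thetaFactor {α : ℝ} (hα : 0 < α) (t : ℝ) :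
    Real.exp (-(1 / (4 * α)) * t ^ 2) * thetaFactor α t = thetaSum 0 α t := by
  have hs := summable_thetaTerm 0 hα t
  unfold thetaSum
  have h1 : Summable fun n : ℕ => thetaTerm 0 α (t + 2 * Real.pi * ((n + 1 : ℤ) : ℝ)) :=
    hs.comp_injective (i := fun n : ℕ => (n + 1 : ℤ)) fun a b h => by simpa using h
  have h2 : Summable fun n : ℕ => thetaTerm 0 α (t + 2 * Real.pi * ((-(n + 1) : ℤ) : ℝ)) :=
    hs.comp_injective (i := fun n : ℕ => (-(n + 1) : ℤ)) fun a b h => by simpa using h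
  have h := (h1.hasSum.of_add_one_of_neg_add_one
    (f := fun n : ℤ => thetaTerm 0 α (t + 2 * Real.pi * n)) h2.hasSum).tsum_eq
  rw [h]
  have h3 := h1.tsum_add h2
  have h4 : ∀ n : ℕ, thetaTerm 0 α (t + 2 * Real.pi * ((n + 1 : ℤ) : ℝ)) +
      thetaTerm 0 α (t + 2 * Real.pi * ((-(n + 1) : ℤ) : ℝ)) =
      Real.exp (-(1 / (4 * α)) * t ^ 2) * (2 * (Real.exp (-(Real.pi ^ 2 * ((n : ℝ) + 1) ^ 2) / α)
        * Real.cosh (((n : ℝ) + 1) * Real.pi / α * t))) := by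
    intro n
    simp only [thetaTerm, Real.cosh_eq]
    have e1 : Real.exp (-(t + 2 * Real.pi * ((n + 1 : ℤ) : ℝ)) ^ 2 / (4 * α)) =
        Real.exp (-(1 / (4 * α)) * t ^ 2) * Real.exp (-(Real.pi ^ 2 * ((n : ℝ) + 1) ^ 2) / α)
          * Real.exp (-(((n : ℝ) + 1) * Real.pi / α * t)) := by
      rw [← Real.exp_add, ← Real.exp_add]; congr 1; push_cast; field_simp; ring
    have e2 : Real.exp (-(t + 2 * Real.pi * ((-(n + 1) : ℤ) : ℝ)) ^ 2 / (4 * α)) =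
        Real.exp (-(1 / (4 * α)) * t ^ 2) * Real.exp (-(Real.pi ^ 2 * ((n : ℝ) + 1) ^ 2) / α)
          * Real.exp ((((n : ℝ) + 1) * Real.pi / α * t)) := by
      rw [← Real.exp_add, ← Real.exp_add]; congr 1; push_cast; field_simp; ring
    rw [e1, e2]; ring
  rw [tsum_congr h4, tsum_mul_left, tsum_mul_left] at h3
  have h5 : thetaTerm 0 α (t + 2 * Real.pi * ((0 : ℤ) : ℝ)) =
      Real.exp (-(1 / (4 * α)) * t ^ 2) := by
    simp only [thetaTerm]; congr 1; simp; field_simp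
  rw [h5, thetaFactor, mul_add, h3]
  ring

@[fun_prop]
lemma measurable_thetaTerm (j : ℕ) : Measurable fun p : ℝ × ℝ => thetaTerm j p.1 p.2 := by
  rcases j with _ | _ | j <;> simp only [thetaTerm] <;> fun_prop

lemma measurable_thetaSum (j : ℕ) : Measurable fun p : ℝ × ℝ => thetaSum j p.1 p.2 :=
  Measurable.tsum fun n => (measurable_thetaTerm j).comp
    (f := fun p : ℝ × ℝ => (p.1, p.2 + 2 * Real.pi * n)) (by fun_prop)

end TensorField

namespace TensorField

open MeasureTheory

/-! ## Sliced kernels and their derivatives -/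

/-- The sliced propagator as a function of the difference of the angles, with `j s`
derivatives in direction `s`. -/
noncomputable def kern (M m : ℝ) (i : ℕ) (j : Fin 4 → ℕ) (z : Fin 4 → ℝ) : ℝ :=
  Real.pi ^ 2 * ∫ α in slice M i,
    Real.exp (-m ^ 2 * α) / α ^ 2 * ∏ s, thetaSum (j s) α (z s)

lemma measurableSet_slice (M : ℝ) (i : ℕ) : MeasurableSet (slice M i) := by
  cases i
  · exact measurableSet_Ioi
  · exact measurableSet_Ioc

lemma lt_of_mem_slice {M α : ℝ} {i : ℕ} (h : α ∈ slice M i) : (M ^ (2 * (i + 1)))⁻¹ < α := by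
  cases i
  · simpa [slice] using h
  · exact h.1

lemma pos_of_mem_slice {M α : ℝ} (hM : 1 < M) {i : ℕ} (h : α ∈ slice M i) : 0 < α :=
  lt_of_le_of_lt (by positivity) (lt_of_mem_slice h)

lemma le_of_mem_slice {M α : ℝ} {i : ℕ} (hi : i ≠ 0) (h : α ∈ slice M i) :
    α ≤ (M ^ (2 * i))⁻¹ := by
  cases i
  · exact absurd rfl hi
  · exact h.2

lemma sliceKernel_eq_kern {M : ℝ} (hM : 1 < M) (m : ℝ) (i : ℕ) (x y : Fin 4 → ℝ) :
    sliceKernel M m i x y = kern M m i 0 (x - y) := by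
  unfold sliceKernel kern
  congr 1
  refine setIntegral_congr_fun (measurableSet_slice M i) fun α hα => ?_
  have hα := pos_of_mem_slice hM hα
  simp only [Pi.zero_apply, Pi.sub_apply]
  simp_rw [← exp_mul_thetaFactor hα]
  rw [Finset.prod_mul_distrib, ← Real.exp_sum, Finset.mul_sum, mul_assoc]

lemma thetaWeight_le {α a : ℝ} (ha : 0 < a) (h : a < α) (j : ℕ) :
    thetaWeight j α ≤ 1 + 2 / a := by
  have h0 : 0 < α := ha.trans h
  have h1 : 2 / α ≤ 2 / a := by gcongr
  have h2 : 1 / (4 * α) ≤ 2 / α := by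
    rw [div_le_div_iff₀ (by positivity) h0]; linarith
  have h3 : 0 < 2 / a := by positivity
  rcases j with _ | _ | j <;> simp only [thetaWeight] <;> linarith

/-- The lower end of the slice controls `1/α²` and the weights, and half of the mass exponential
absorbs `(1 + α)⁴` from the four theta sums. The bound depends on `i`; it is a dominating function,
and the actual estimate only for scale `0`. -/
lemma exists_kernIntegrand_bound {M m : ℝ} (hM : 1 < M) (hm : 0 < m) (i : ℕ) :
    ∃ A : ℝ, 0 ≤ A ∧ ∀ α ∈ slice M i, ∀ (j : Fin 4 → ℕ) (z : Fin 4 → ℝ),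
      ‖Real.exp (-m ^ 2 * α) / α ^ 2 * ∏ s, thetaSum (j s) α (z s)‖ ≤
        A * Real.exp (-(m ^ 2 / 2) * α) := by
  set a := (M ^ (2 * (i + 1)))⁻¹ with ha
  have ha0 : 0 < a := by positivity
  set W := (1 + 2 / a) * (2 * thetaConst) with hW
  have hc := one_le_thetaConst
  have hW0 : 0 ≤ W := by positivity
  refine ⟨1 / a ^ 2 * (W ^ 4 * (24 * (2 / m ^ 2) ^ 4 * Real.exp (m ^ 2 / 2))), by positivity,
    fun α hα j z => ?_⟩
  have hlt := lt_of_mem_slice hα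
  have h0 := pos_of_mem_slice hM hα
  have h1 : ∀ s, |thetaSum (j s) α (z s)| ≤ W * (1 + α) := fun s => by
    refine (abs_thetaSum_le _ h0 _).trans ?_
    have := thetaSum_zero_le (by linarith : 0 < 2 * α) (z s)
    have h2 : thetaSum 0 (2 * α) (z s) ≤ 2 * thetaConst * (1 + α) := by nlinarith
    calc _ ≤ (1 + 2 / a) * (2 * thetaConst * (1 + α)) := by
          gcongr
          · exact thetaSum_zero_nonneg _ _
          · exact thetaWeight_le ha0 hlt _
      _ = _ := by ring
  have h2 : |∏ s, thetaSum (j s) α (z s)| ≤ W ^ 4 * (1 + α) ^ 4 := by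
    rw [Finset.abs_prod]
    refine (Finset.prod_le_prod (fun _ _ => abs_nonneg _) fun s _ => h1 s).trans ?_
    rw [Finset.prod_const, ← mul_pow]
    simp
  -- This is `x⁴ / 4! ≤ e^x` at `x = (m² / 2)(1 + α)`.
  have h3 : (1 + α) ^ 4 ≤ 24 * (2 / m ^ 2) ^ 4 * Real.exp (m ^ 2 / 2) *
      Real.exp (m ^ 2 / 2 * α) := by
    have h4 := Real.pow_div_factorial_le_exp (m ^ 2 / 2 * (1 + α)) (by positivity) 4
    rw [mul_add, mul_one, Real.exp_add, div_le_iff₀ (by positivity)] at h4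
    have h5 : (1 + α) ^ 4 = (2 / m ^ 2) ^ 4 * (m ^ 2 / 2 + m ^ 2 / 2 * α) ^ 4 := by
      rw [← mul_pow]; congr 1; field_simp
    rw [h5]
    calc _ ≤ (2 / m ^ 2) ^ 4 * (Real.exp (m ^ 2 / 2) * Real.exp (m ^ 2 / 2 * α) *
          (Nat.factorial 4 : ℝ)) := by gcongr
      _ = _ := by simp [Nat.factorial]; ring
  have h6 : Real.exp (-m ^ 2 * α) * Real.exp (m ^ 2 / 2 * α) = Real.exp (-(m ^ 2 / 2) * α) := by
    rw [← Real.exp_add]; congr 1; ring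
  rw [Real.norm_eq_abs, abs_mul, abs_of_pos (by positivity)]
  calc Real.exp (-m ^ 2 * α) / α ^ 2 * |∏ s, thetaSum (j s) α (z s)|
      ≤ Real.exp (-m ^ 2 * α) / a ^ 2 * (W ^ 4 * (24 * (2 / m ^ 2) ^ 4 * Real.exp (m ^ 2 / 2) *
      Real.exp (m ^ 2 / 2 * α))) := by
        gcongr
        exact h2.trans (by gcongr)
    _ = _ := by rw [← h6]; ring

lemma integrableOn_slice_exp {M m : ℝ} (hM : 1 < M) (hm : 0 < m) (i : ℕ) (A : ℝ) :
    IntegrableOn (fun α => A * Real.exp (-(m ^ 2 / 2) * α)) (slice M i) :=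
  ((exp_neg_integrableOn_Ioi 0 (by positivity)).mono_set
    fun _ h => pos_of_mem_slice hM h).const_mul A

@[fun_prop]
lemma measurable_kernIntegrand (m : ℝ) (j : Fin 4 → ℕ) :
    Measurable fun p : (Fin 4 → ℝ) × ℝ =>
      Real.exp (-m ^ 2 * p.2) / p.2 ^ 2 * ∏ s, thetaSum (j s) p.2 (p.1 s) := by
  refine Measurable.mul (by fun_prop) (Finset.measurable_prod _ fun s _ => ?_)
  exact (measurable_thetaSum (j s)).comp (f := fun p : (Fin 4 → ℝ) × ℝ => (p.2, p.1 s))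
    (by fun_prop)

lemma measurable_kernIntegrand_right (m : ℝ) (j : Fin 4 → ℕ) (z : Fin 4 → ℝ) :
    Measurable fun α : ℝ => Real.exp (-m ^ 2 * α) / α ^ 2 * ∏ s, thetaSum (j s) α (z s) :=
  (measurable_kernIntegrand m j).comp (f := fun α : ℝ => (z, α)) (by fun_prop)

lemma measurable_kern (M m : ℝ) (i : ℕ) (j : Fin 4 → ℕ) : Measurable (kern M m i j) := by
  unfold kern
  refine Measurable.const_mul ?_ _
  exact (measurable_kernIntegrand m j).stronglyMeasurable.integral_prod_right'.measurable

lemma integrableOn_kernIntegrand {M m : ℝ} (hM : 1 < M) (hm : 0 < m) (i : ℕ) (j : Fin 4 → ℕ)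
    (z : Fin 4 → ℝ) :
    IntegrableOn (fun α => Real.exp (-m ^ 2 * α) / α ^ 2 * ∏ s, thetaSum (j s) α (z s))
      (slice M i) := by
  obtain ⟨A, -, h⟩ := exists_kernIntegrand_bound hM hm i
  exact (integrableOn_slice_exp hM hm i A).mono'
    (measurable_kernIntegrand_right m j z).aestronglyMeasurable
    (ae_restrict_of_forall_mem (measurableSet_slice M i) fun α hα => h α hα j z)

lemma hasDerivAt_prod_thetaSum {α : ℝ} (hα : 0 < α) (j : Fin 4 → ℕ) (z : Fin 4 → ℝ) {s : Fin 4}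
    (hj : j s ≤ 1) (t : ℝ) :
    HasDerivAt (fun t => ∏ r, thetaSum (j r) α (Function.update z s t r))
      (∏ r, thetaSum (Function.update j s (j s + 1) r) α (Function.update z s t r)) t := by
  have h := (hasDerivAt_thetaSum hj hα t).mul_const
    (∏ r ∈ Finset.univ.erase s, thetaSum (j r) α (z r))
  have e1 : ∀ t, ∏ r, thetaSum (j r) α (Function.update z s t r) =
      thetaSum (j s) α t * ∏ r ∈ Finset.univ.erase s, thetaSum (j r) α (z r) := fun t => by
    rw [← Finset.mul_prod_erase _ _ (Finset.mem_univ s), Function.update_self]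
    congr 1
    refine Finset.prod_congr rfl fun r hr => ?_
    rw [Function.update_of_ne (Finset.ne_of_mem_erase hr)]
  have e2 : ∏ r, thetaSum (Function.update j s (j s + 1) r) α (Function.update z s t r) =
      thetaSum (j s + 1) α t * ∏ r ∈ Finset.univ.erase s, thetaSum (j r) α (z r) := by
    rw [← Finset.mul_prod_erase _ _ (Finset.mem_univ s), Function.update_self,
      Function.update_self]
    congr 1
    refine Finset.prod_congr rfl fun r hr => ?_
    rw [Function.update_of_ne (Finset.ne_of_mem_erase hr),
      Function.update_of_ne (Finset.ne_of_mem_erase hr)]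
  simp_rw [e1]
  rw [e2]
  exact h

/-- Differentiation under the integral; the dominating function does not depend on the angles, so
the whole line serves as the neighbourhood. -/
lemma hasDerivAt_kern {M m : ℝ} (hM : 1 < M) (hm : 0 < m) (i : ℕ) (j : Fin 4 → ℕ)
    (z : Fin 4 → ℝ) {s : Fin 4} (hj : j s ≤ 1) (t : ℝ) :
    HasDerivAt (fun t => kern M m i j (Function.update z s t))
      (kern M m i (Function.update j s (j s + 1)) (Function.update z s t)) t := by
  obtain ⟨A, -, hA⟩ := exists_kernIntegrand_bound hM hm i
  refine HasDerivAt.const_mul (Real.pi ^ 2) ?_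
  refine (hasDerivAt_integral_of_dominated_loc_of_deriv_le (Filter.univ_mem)
    (F := fun t α => Real.exp (-m ^ 2 * α) / α ^ 2 *
      ∏ r, thetaSum (j r) α (Function.update z s t r))
    (F' := fun t α => Real.exp (-m ^ 2 * α) / α ^ 2 *
      ∏ r, thetaSum (Function.update j s (j s + 1) r) α (Function.update z s t r))
    (.of_forall fun t => (measurable_kernIntegrand_right m j _).aestronglyMeasurable)
    (integrableOn_kernIntegrand hM hm i j _)
    (measurable_kernIntegrand_right m _ _).aestronglyMeasurable ?_
    (integrableOn_slice_exp hM hm i A) ?_).2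
  · exact ae_restrict_of_forall_mem (measurableSet_slice M i) fun α hα t _ => hA α hα _ _
  · exact ae_restrict_of_forall_mem (measurableSet_slice M i) fun α hα t _ =>
      (hasDerivAt_prod_thetaSum (pos_of_mem_slice hM hα) j z hj t).const_mul _

lemma laplacian_kern {M m : ℝ} (hM : 1 < M) (hm : 0 < m) (i : ℕ) (x y : Fin 4 → ℝ) :
    laplacian (fun x => ((kern M m i 0 (x - y) : ℝ) : ℂ)) x =
      ((∑ s, kern M m i (Function.update 0 s 2) (x - y) : ℝ) : ℂ) := by
  unfold laplacian
  rw [Complex.ofReal_sum]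
  refine Finset.sum_congr rfl fun s _ => ?_
  have hu : ∀ t, Function.update x s t - y = Function.update (x - y) s (t - y s) := fun t => by
    ext r
    by_cases hr : r = s
    · subst hr; simp
    · simp [hr]
  have hd : ∀ (j : Fin 4 → ℕ), j s ≤ 1 → ∀ t,
      HasDerivAt (fun t => ((kern M m i j (Function.update x s t - y) : ℝ) : ℂ))
      ((kern M m i (Function.update j s (j s + 1)) (Function.update x s t - y) : ℝ) : ℂ) t := by
    intro j hj t
    simp_rw [hu]
    exact ((hasDerivAt_kern hM hm i j (x - y) hj (t - y s)).comp_sub_const t (y s)).ofReal_comp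
  rw [iteratedDeriv_succ, iteratedDeriv_one]
  rw [show deriv (fun t => ((kern M m i 0 (Function.update x s t - y) : ℝ) : ℂ)) = _ from
    funext fun t => (hd 0 (by simp) t).deriv]
  rw [(hd _ (by simp) _).deriv]
  simp

/-! ## Uniform bounds -/

/-- The bound on one strand of a propagator of scale `i`. -/
noncomputable def strandBound (M : ℝ) (i : ℕ) (t : ℝ) : ℝ :=
  -- In slice `0` the parameter `α` has no upper end, and no decay is needed because `M^0 = 1`.
  -- Otherwise the parameter is twice the upper end of the slice, the doubling being that of
  -- `abs_thetaTerm_le`.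
  if i = 0 then 1 else thetaSum 0 (2 * (M ^ (2 * i))⁻¹) t

lemma strandBound_nonneg (M : ℝ) (i : ℕ) (t : ℝ) : 0 ≤ strandBound M i t := by
  unfold strandBound
  split_ifs
  · exact zero_le_one
  · exact thetaSum_zero_nonneg _ _

@[fun_prop]
lemma measurable_strandBound (M : ℝ) (i : ℕ) : Measurable (strandBound M i) := by
  unfold strandBound
  split_ifs
  · fun_prop
  · exact (measurable_thetaSum 0).comp (f := fun t : ℝ => (2 * (M ^ (2 * i))⁻¹, t)) (by fun_prop)

lemma strandBound_le {M : ℝ} (hM : 1 < M) (i : ℕ) (t : ℝ) :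
    strandBound M i t ≤ 3 * thetaConst := by
  have hc := one_le_thetaConst
  unfold strandBound
  split_ifs
  · linarith
  · have h0 : 0 < 2 * (M ^ (2 * i))⁻¹ := by positivity
    have h1 : (M ^ (2 * i))⁻¹ ≤ 1 := inv_le_one_of_one_le₀ (one_le_pow₀ hM.le)
    have := thetaSum_zero_le h0 t
    nlinarith

/-- The factor `1/α²` is at most `M^(4(i+1))` and the slice has length at most `M^(-2i)`, whence
`M^4 · M^(2i)`. Monotonicity in `α` replaces each theta sum by its value at the upper end. -/
lemma abs_kern_le_of_weight {M m : ℝ} (hM : 1 < M) {i : ℕ} (hi : i ≠ 0) {j : Fin 4 → ℕ}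
    {W : ℝ} (hW : 0 ≤ W) (hjW : ∀ α ∈ slice M i, ∏ s, thetaWeight (j s) α ≤ W) (z : Fin 4 → ℝ) :
    |kern M m i j z| ≤ Real.pi ^ 2 * M ^ 4 * M ^ (2 * i) * W * ∏ s, strandBound M i (z s) := by
  set P := ∏ s, strandBound M i (z s) with hP
  have hP0 : 0 ≤ P := Finset.prod_nonneg fun s _ => strandBound_nonneg _ _ _
  have hbd : ∀ α ∈ slice M i,
      ‖Real.exp (-m ^ 2 * α) / α ^ 2 * ∏ s, thetaSum (j s) α (z s)‖ ≤
        (M ^ (2 * (i + 1))) ^ 2 * (W * P) := by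
    intro α hα
    have h0 := pos_of_mem_slice hM hα
    have h1 : |∏ s, thetaSum (j s) α (z s)| ≤ W * P := by
      rw [Finset.abs_prod]
      calc ∏ s, |thetaSum (j s) α (z s)|
          ≤ ∏ s, thetaWeight (j s) α * strandBound M i (z s) := by
            refine Finset.prod_le_prod (fun _ _ => abs_nonneg _) fun s _ => ?_
            refine (abs_thetaSum_le _ h0 _).trans ?_
            have := thetaWeight_nonneg (j s) h0
            gcongr
            simp only [strandBound, hi, if_false]
            exact thetaSum_zero_mono (by linarith)
              (by linarith [le_of_mem_slice hi hα]) _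
        _ = (∏ s, thetaWeight (j s) α) * P := Finset.prod_mul_distrib
        _ ≤ W * P := by gcongr; exact hjW α hα
    have h2 : Real.exp (-m ^ 2 * α) ≤ 1 := by
      rw [Real.exp_le_one_iff]; nlinarith [sq_nonneg m]
    have h3 : 1 / α ≤ M ^ (2 * (i + 1)) := by
      rw [one_div]
      exact inv_le_of_inv_le₀ (by positivity) (lt_of_mem_slice hα).le
    rw [Real.norm_eq_abs, abs_mul, abs_of_pos (by positivity)]
    calc _ ≤ 1 / α ^ 2 * (W * P) := by gcongr
      _ = (1 / α) ^ 2 * (W * P) := by ring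
      _ ≤ _ := by gcongr
  have hvol : volume.real (slice M i) ≤ (M ^ (2 * i))⁻¹ := by
    have hsub : slice M i ⊆ Set.Ioc 0 (M ^ (2 * i))⁻¹ := fun α hα =>
      ⟨pos_of_mem_slice hM hα, le_of_mem_slice hi hα⟩
    refine (measureReal_mono hsub (by simp)).trans ?_
    rw [Real.volume_real_Ioc_of_le (by positivity), sub_zero]
  have hfin : volume (slice M i) < ⊤ := by
    obtain ⟨k, rfl⟩ := Nat.exists_eq_succ_of_ne_zero hi
    simp [slice]
  have hint := norm_setIntegral_le_of_norm_le_const hfin hbd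
  unfold kern
  rw [abs_mul, abs_of_pos (by positivity), ← Real.norm_eq_abs (∫ _ in _, _)]
  calc _ ≤ Real.pi ^ 2 * ((M ^ (2 * (i + 1))) ^ 2 * (W * P) * (M ^ (2 * i))⁻¹) := by
        gcongr
        exact hint.trans (by gcongr)
    _ = _ := by
        field_simp
        ring

/-- Bounds on the sliced propagator and its Laplacian, uniform in the scale. -/
lemma exists_kern_bound {M m : ℝ} (hM : 1 < M) (hm : 0 < m) :
    ∃ C : ℝ, 1 ≤ C ∧ ∀ (i : ℕ) (z : Fin 4 → ℝ),
      |kern M m i 0 z| ≤ C * M ^ (2 * i) * ∏ s, strandBound M i (z s) ∧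
      |∑ s, kern M m i (Function.update 0 s 2) z| ≤
        C * M ^ (4 * i) * ∏ s, strandBound M i (z s) := by
  obtain ⟨A, hA0, hA⟩ := exists_kernIntegrand_bound hM hm 0
  set I := ∫ α in slice M 0, A * Real.exp (-(m ^ 2 / 2) * α) with hI
  have hI0 : 0 ≤ I := integral_nonneg fun α => by positivity
  have h0 : ∀ j z, |kern M m 0 j z| ≤ Real.pi ^ 2 * I := fun j z => by
    unfold kern
    rw [abs_mul, abs_of_pos (by positivity)]
    gcongr
    rw [← Real.norm_eq_abs]
    exact norm_integral_le_of_norm_le (integrableOn_slice_exp hM hm 0 A)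
      (ae_restrict_of_forall_mem (measurableSet_slice M 0) fun α hα => hA α hα j z)
  -- The second term serves scale `0`, with four directions of the Laplacian. The third serves the
  -- other scales: four directions times the `2` of the weight `2/α`, whose bound `2 M^(2(i+1))`
  -- turns `M^4` into `M^6`.
  set C := 1 + 4 * (Real.pi ^ 2 * I) + 8 * (Real.pi ^ 2 * M ^ 6) with hC
  have hM4 : M ^ 4 ≤ M ^ 6 := pow_le_pow_right₀ hM.le (by norm_num)
  have hp : 0 ≤ Real.pi ^ 2 * I := by positivity
  have hp6 : 0 ≤ Real.pi ^ 2 * M ^ 6 := by positivity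
  refine ⟨C, by linarith, fun i z => ?_⟩
  have hP0 : 0 ≤ ∏ s, strandBound M i (z s) :=
    Finset.prod_nonneg fun s _ => strandBound_nonneg _ _ _
  by_cases hi : i = 0
  · subst hi
    simp only [mul_zero, pow_zero, mul_one, strandBound, if_true, Finset.prod_const_one]
    refine ⟨(h0 _ _).trans (by linarith), (Finset.abs_sum_le_sum_abs _ _).trans ?_⟩
    refine (Finset.sum_le_sum fun s _ => h0 _ z).trans ?_
    simp only [Finset.sum_const, Finset.card_univ, Fintype.card_fin, nsmul_eq_mul]
    push_cast
    linarith
  · constructor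
    · refine (abs_kern_le_of_weight hM hi (W := 1) zero_le_one (fun α _ => ?_) z).trans ?_
      · simp [thetaWeight]
      · have : Real.pi ^ 2 * M ^ 4 ≤ C := by
          have : Real.pi ^ 2 * M ^ 4 ≤ Real.pi ^ 2 * M ^ 6 := by gcongr
          linarith
        rw [mul_one]
        gcongr
    · have hs : ∀ s : Fin 4, |kern M m i (Function.update 0 s 2) z| ≤
          2 * (Real.pi ^ 2 * M ^ 6) * M ^ (4 * i) * ∏ s, strandBound M i (z s) := fun s => by
        refine (abs_kern_le_of_weight hM hi (W := 2 * M ^ (2 * (i + 1))) (by positivity)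
          (fun α hα => ?_) z).trans (le_of_eq (by ring))
        have h1 : α⁻¹ ≤ M ^ (2 * (i + 1)) :=
          inv_le_of_inv_le₀ (by positivity) (lt_of_mem_slice hα).le
        rw [← Finset.mul_prod_erase _ _ (Finset.mem_univ s), Function.update_self,
          Finset.prod_eq_one (fun r hr => by
            rw [Function.update_of_ne (Finset.ne_of_mem_erase hr)]; rfl), mul_one]
        change 2 / α ≤ _
        rw [div_eq_mul_inv]
        gcongr
      refine (Finset.abs_sum_le_sum_abs _ _).trans ?_
      refine (Finset.sum_le_sum fun s _ => hs s).trans ?_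
      simp only [Finset.sum_const, Finset.card_univ, Fintype.card_fin, nsmul_eq_mul]
      push_cast
      calc _ = 8 * (Real.pi ^ 2 * M ^ 6) * M ^ (4 * i) * ∏ s, strandBound M i (z s) := by ring
        _ ≤ _ := by gcongr; linarith

/-! ## Integration over one angle -/

instance : IsProbabilityMeasure haarAngle := ⟨by
  have h : ENNReal.ofReal (2 * Real.pi) ≠ 0 := by simp [Real.pi_pos]
  simp only [haarAngle, Measure.smul_apply, Measure.restrict_apply_univ, Real.volume_Ioc, sub_zero,
    smul_eq_mul]
  exact ENNReal.inv_mul_cancel h ENNReal.ofReal_ne_top⟩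

/-- Unfolding: the sum over translates on a fundamental domain becomes a Gaussian integral over the
real line. -/
lemma lintegral_thetaSum {α : ℝ} (hα : 0 < α) (y : ℝ) :
    ∫⁻ x in Set.Ioc 0 (2 * Real.pi), ENNReal.ofReal (thetaSum 0 α (x - y)) =
      ENNReal.ofReal (Real.sqrt (4 * Real.pi * α)) := by
  have hf : ∀ x, ENNReal.ofReal (thetaSum 0 α (x - y)) =
      ∑' n : ℤ, ENNReal.ofReal (thetaTerm 0 α (x - y + 2 * Real.pi * n)) := fun x =>
    ENNReal.ofReal_tsum_of_nonneg (fun n => (thetaTerm_zero_pos _ _).le) (summable_thetaTerm 0 hα _)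
  simp_rw [hf]
  have hmeas : ∀ n : ℤ,
      Measurable fun x : ℝ => ENNReal.ofReal (thetaTerm 0 α (x - y + 2 * Real.pi * n)) :=
    fun n => ((measurable_thetaTerm 0).comp
      (f := fun x : ℝ => (α, x - y + 2 * Real.pi * n)) (by fun_prop)).ennreal_ofReal
  rw [lintegral_tsum fun n => (hmeas n).aemeasurable]
  have hfd := (isAddFundamentalDomain_Ioc Real.two_pi_pos 0).lintegral_eq_tsum''
    (fun x => ENNReal.ofReal (thetaTerm 0 α (x - y)))
  rw [zero_add] at hfd
  have hb : Function.Bijective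
      (fun n : ℤ => (⟨n • (2 * Real.pi), n, rfl⟩ : AddSubgroup.zmultiples (2 * Real.pi))) :=
    (Equiv.ofInjective (fun n : ℤ => n • (2 * Real.pi))
      (zsmul_left_strictMono Real.two_pi_pos).injective).bijective
  rw [← (Equiv.ofBijective _ hb).tsum_eq] at hfd
  have he : ∑' n : ℤ, ∫⁻ x in Set.Ioc 0 (2 * Real.pi),
      ENNReal.ofReal (thetaTerm 0 α (x - y + 2 * Real.pi * n)) =
      ∫⁻ x, ENNReal.ofReal (thetaTerm 0 α (x - y)) := by
    rw [hfd]
    refine tsum_congr fun n => lintegral_congr fun x => ?_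
    simp only [Equiv.ofBijective_apply, AddSubgroup.vadd_def, vadd_eq_add, zsmul_eq_mul]
    congr 2; ring
  rw [he, lintegral_sub_right_eq_self (fun x => ENNReal.ofReal (thetaTerm 0 α x)) y]
  have hg : thetaTerm 0 α = fun x => Real.exp (-(1 / (4 * α)) * x ^ 2) := by
    ext x; simp only [thetaTerm]; congr 1; field_simp
  rw [← ofReal_integral_eq_lintegral_ofReal]
  · simp only [hg]
    rw [integral_gaussian]
    congr 2; field_simp
  · rw [hg]; exact integrable_exp_neg_mul_sq (by positivity)
  · exact .of_forall fun x => (thetaTerm_zero_pos _ _).le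

/-- The constant is exactly one because `8π ≤ 4π²`; at scale `0` the measure is a probability
measure. -/
lemma lintegral_strandBound_le {M : ℝ} (hM : 1 < M) (i : ℕ) (y : ℝ) :
    ∫⁻ x, ENNReal.ofReal (strandBound M i (x - y)) ∂haarAngle ≤ ENNReal.ofReal ((M ^ i)⁻¹) := by
  unfold strandBound
  split_ifs with hi
  · subst hi; simp
  · rw [haarAngle, lintegral_smul_measure, lintegral_thetaSum (by positivity), smul_eq_mul,
      ← ENNReal.ofReal_inv_of_pos Real.two_pi_pos, ← ENNReal.ofReal_mul (by positivity)]
    refine ENNReal.ofReal_le_ofReal ?_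
    have h : Real.sqrt (4 * Real.pi * (2 * (M ^ (2 * i))⁻¹)) ≤ 2 * Real.pi * (M ^ i)⁻¹ := by
      refine Real.sqrt_le_iff.2 ⟨by positivity, ?_⟩
      have : (2 * Real.pi * (M ^ i)⁻¹) ^ 2 = 4 * Real.pi ^ 2 * (M ^ (2 * i))⁻¹ := by
        rw [pow_mul' M 2 i]; field_simp; ring
      rw [this]
      have h2 : 0 < (M ^ (2 * i))⁻¹ := by positivity
      have h3 : 8 * Real.pi ≤ 4 * Real.pi ^ 2 := by nlinarith [Real.pi_gt_three]
      calc _ = 8 * Real.pi * (M ^ (2 * i))⁻¹ := by ring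
        _ ≤ _ := by gcongr
    calc _ ≤ (2 * Real.pi)⁻¹ * (2 * Real.pi * (M ^ i)⁻¹) := by gcongr
      _ = _ := by field_simp

end TensorField

namespace TensorField

open MeasureTheory

/-! ## Integration along a forest of strands -/

-- The condition `hS` supplies an edge whose head is the tail of no edge. Heads being distinct, that
-- angle occurs in a single factor and can be integrated first; `hS` passes to the remaining edges,
-- and the argument repeats.
open Classical in
lemma lintegral_prod_forest_le {X E : Type*} [Fintype X] {head tail : E → X}
    (hhead : Function.Injective head) (ν : Measure ℝ) [IsProbabilityMeasure ν]
    {g : E → ℝ → ENNReal} (hg : ∀ e, Measurable (g e)) {c : E → ENNReal}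
    (hc : ∀ e y, ∫⁻ x, g e (x - y) ∂ν ≤ c e) (S : Finset E)
    (hS : ∀ T ⊆ S, T.Nonempty → ∃ e ∈ T, ∀ e' ∈ T, head e ≠ tail e') :
    ∫⁻ θ : X → ℝ, ∏ e ∈ S, g e (θ (head e) - θ (tail e)) ∂Measure.pi (fun _ => ν) ≤
      ∏ e ∈ S, c e := by
  induction S using Finset.strongInduction with
  | H S ih =>
  rcases S.eq_empty_or_nonempty with rfl | hne
  · simp
  obtain ⟨e, he, hter⟩ := hS S subset_rfl hne
  have hmeas : ∀ T : Finset E, Measurable fun θ : X → ℝ =>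
      ∏ e ∈ T, g e (θ (head e) - θ (tail e)) := fun T =>
    Finset.measurable_prod _ fun e _ => (hg e).comp (by fun_prop)
  have hle := ih (S.erase e) (Finset.erase_ssubset he)
    fun T hT => hS T (hT.trans (Finset.erase_subset _ _))
  calc ∫⁻ θ : X → ℝ, ∏ e ∈ S, g e (θ (head e) - θ (tail e)) ∂Measure.pi (fun _ => ν)
      ≤ ∫⁻ θ : X → ℝ, c e * ∏ e ∈ S.erase e, g e (θ (head e) - θ (tail e))
          ∂Measure.pi (fun _ => ν) := by
        refine lintegral_le_of_lmarginal_le {head e} (hmeas S) ((hmeas _).const_mul _) ?_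
        rw [lmarginal_singleton, lmarginal_singleton]
        intro θ
        have hrest : ∀ x, ∏ e' ∈ S.erase e, g e' (Function.update θ (head e) x (head e') -
            Function.update θ (head e) x (tail e')) =
            ∏ e' ∈ S.erase e, g e' (θ (head e') - θ (tail e')) := fun x => by
          refine Finset.prod_congr rfl fun e' he' => ?_
          rw [Function.update_of_ne fun h => Finset.ne_of_mem_erase he' (hhead h),
            Function.update_of_ne fun h => hter e' (Finset.mem_of_mem_erase he') h.symm]
        simp only [← Finset.mul_prod_erase _ _ he, hrest, Function.update_self,
          Function.update_of_ne (hter e he).symm]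
        have hmeas_e : Measurable fun x : ℝ => g e (x - θ (tail e)) := (hg e).comp (by fun_prop)
        rw [lintegral_mul_const _ hmeas_e, lintegral_const, measure_univ,
          mul_one]
        gcongr
        exact hc _ _
    _ = c e * ∫⁻ θ : X → ℝ, ∏ e ∈ S.erase e, g e (θ (head e) - θ (tail e))
          ∂Measure.pi (fun _ => ν) := lintegral_const_mul _ (hmeas _)
    _ ≤ c e * ∏ e ∈ S.erase e, c e := by gcongr
    _ = _ := Finset.mul_prod_erase _ _ he

namespace FeynmanGraph

variable {G : FeynmanGraph}

/-! ## Strands and faces -/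

/-- The angle at the `φ`-end of a strand. -/
def head (x : G.Strand) : G.Field × Fin 4 := (G.phiEnd x.1, x.2)

/-- The angle at the `φ̄`-end of a strand. -/
def tail (x : G.Strand) : G.Field × Fin 4 := ((G.partner x.2).symm (G.phibarEnd x.1), x.2)

lemma head_injective : Function.Injective (head (G := G)) := fun x y h => by
  simp only [head, Prod.mk.injEq] at h
  exact Prod.ext (G.phiEnd.injective h.1) h.2

lemma tail_injective : Function.Injective (tail (G := G)) := fun x y h => by
  simp only [tail, Prod.mk.injEq] at h
  obtain ⟨h1, h2⟩ := h
  rw [h2] at h1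
  exact Prod.ext (G.phibarEnd.injective ((G.partner y.2).symm.injective h1)) h2

/-- Turns the combinatorics of faces into incidence of angles; with injectivity of `head` and
`tail`, each strand has at most one successor and one predecessor. -/
lemma follows_iff {x y : G.Strand} : G.Follows x y ↔ head x = tail y := by
  simp only [Follows, head, tail, Prod.mk.injEq, Equiv.eq_symm_apply]
  constructor
  · rintro ⟨h1, h2⟩
    exact ⟨h1 ▸ h2, h1⟩
  · rintro ⟨h1, h2⟩
    exact ⟨h2, h2 ▸ h1⟩

lemma mem_of_mem_face {f : Set G.Strand} (hf : ∃ x, f = G.faceOf x) {x y : G.Strand} (hx : x ∈ f)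
    (h : Relation.EqvGen G.Follows x y) : y ∈ f := by
  obtain ⟨z, rfl⟩ := hf
  exact Relation.EqvGen.trans _ _ _ hx h

lemma eq_faceOf_of_mem {f : Set G.Strand} (hf : ∃ x, f = G.faceOf x) {x : G.Strand} (hx : x ∈ f) :
    f = G.faceOf x := by
  obtain ⟨z, rfl⟩ := hf
  ext y
  exact ⟨fun hy => (hx.symm _ _).trans _ _ _ hy, fun hy => Relation.EqvGen.trans _ _ _ hx hy⟩

lemma exists_min_strand (μ : G.Line → ℕ) (f : G.internalFaces) :
    ∃ x ∈ f.1, ∀ y ∈ f.1, μ x.1 ≤ μ y.1 := by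
  obtain ⟨⟨x, hx⟩, -⟩ := f.2
  exact Set.exists_min_image f.1 (fun x => μ x.1) (Set.toFinite _)
    ⟨x, hx ▸ Relation.EqvGen.refl x⟩

/-- If every internal face has a strand outside of `S`, then `S` has no closed circuit. -/
lemma exists_terminal {S : Set G.Strand} (hS : ∀ f ∈ G.internalFaces, ∃ x ∈ f, x ∉ S)
    (T : Finset G.Strand) (hT : (T : Set G.Strand) ⊆ S) (hne : T.Nonempty) :
    ∃ e ∈ T, ∀ e' ∈ T, head e ≠ tail e' := by
  -- Otherwise succession is an injective self-map of the finite set `T`, hence onto. So `T` is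
  -- closed under succession in both directions and contains a whole closed face, contrary to `hS`.
  by_contra! hcon
  choose! next hnext hhead using hcon
  have hinj : Set.InjOn next T := fun a ha b hb h => by
    refine head_injective ?_
    rw [hhead a ha, hhead b hb, h]
  have hsurj : Set.SurjOn next T T :=
    Finset.surjOn_of_injOn_of_card_le next hnext hinj le_rfl
  obtain ⟨x, hx⟩ := hne
  have hstep : ∀ a b, G.Follows a b → (a ∈ T ↔ b ∈ T) := fun a b hab => by
    rw [follows_iff] at hab
    constructor
    · intro ha
      rw [← tail_injective ((hhead a ha).symm.trans hab)]
      exact hnext a ha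
    · intro hb
      obtain ⟨c, hc, rfl⟩ := hsurj hb
      rw [head_injective (hab.trans (hhead c hc).symm)]
      exact hc
  have hclosed : ∀ a b, Relation.EqvGen G.Follows a b → (a ∈ T ↔ b ∈ T) := fun a b hab => by
    induction hab with
    | rel a b h => exact hstep a b h
    | refl => rfl
    | symm _ _ _ ih => exact ih.symm
    | trans _ _ _ _ _ ih1 ih2 => exact ih1.trans ih2
  have hface : G.faceOf x ∈ G.internalFaces :=
    ⟨⟨x, rfl⟩, fun y hy => ⟨next y, follows_iff.2 (hhead y ((hclosed x y hy).1 hx))⟩⟩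
  obtain ⟨y, hy, hyS⟩ := hS _ hface
  exact hyS (hT ((hclosed x y hy).1 hx))

/-! ## Sums over the high subgraphs -/

/-- Exchange of sums: `a` is counted at the levels `0, …, m a`, none of which is cut off by `Λ`. -/
lemma sum_range_card_filter_le {ι : Type*} [Fintype ι] {Λ : ℕ} {m : ι → ℕ} (hm : ∀ a, m a ≤ Λ) :
    ∑ i ∈ Finset.range (Λ + 1), (Finset.univ.filter fun a => i ≤ m a).card =
      ∑ a, (m a + 1) := by
  simp_rw [Finset.card_filter]
  rw [Finset.sum_comm]
  refine Finset.sum_congr rfl fun a _ => ?_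
  rw [← Finset.card_filter]
  have : (Finset.range (Λ + 1)).filter (fun i => i ≤ m a) = Finset.range (m a + 1) := by
    ext i
    simp only [Finset.mem_filter, Finset.mem_range]
    have := hm a
    omega
  rw [this, Finset.card_range]

variable {μ : G.Line → ℕ} {i : ℕ}

lemma mem_componentLines_mk (l : {l : G.Line // i ≤ μ l}) :
    l.1 ∈ componentLines ((highGraph μ i).connectedComponentMk l) :=
  ⟨l, rfl, rfl⟩

-- The components partition the lines. As `L` enters `ω_d` with a minus sign, lines must not be
-- overcounted here.
open Classical in
lemma sum_numLines (μ : G.Line → ℕ) (i : ℕ) :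
    ∑ k : HighComponent μ i, G.numLines (componentLines k) =
      (Finset.univ.filter fun l => i ≤ μ l).card := by
  rw [← Fintype.card_subtype, ← Finset.card_univ, Finset.card_eq_sum_card_fiberwise
    (f := (highGraph μ i).connectedComponentMk) (t := Finset.univ) (by simp)]
  refine Finset.sum_congr rfl fun k _ => ?_
  rw [numLines, componentLines, Set.ncard_image_of_injective _ Subtype.val_injective,
    ← Set.ncard_coe_finset]
  congr 1
  ext l
  simp

lemma connectedComponentMk_eq_of_follows {x y : G.Strand} (h : G.Follows x y)
    (hx : i ≤ μ x.1) (hy : i ≤ μ y.1) :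
    (highGraph μ i).connectedComponentMk ⟨x.1, hx⟩ =
      (highGraph μ i).connectedComponentMk ⟨y.1, hy⟩ := by
  rw [SimpleGraph.ConnectedComponent.eq]
  by_cases hxy : x.1 = y.1
  · simp [hxy]
  · refine SimpleGraph.Adj.reachable ?_
    rw [highGraph, SimpleGraph.fromRel_adj]
    refine ⟨fun h => hxy (congrArg Subtype.val h), Or.inl ⟨(G.phiEnd x.1).1, Or.inl rfl, Or.inr ?_⟩⟩
    rw [← h.2]
    rfl

/-- Consecutive strands of a face share a vertex, so their lines are equal or adjacent, and the
component is constant along the face. -/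
lemma exists_component_of_face {f : Set G.Strand} (hf : f ∈ G.internalFaces)
    (hi : ∀ x ∈ f, i ≤ μ x.1) :
    ∃ k : HighComponent μ i, ∀ x ∈ f, x.1 ∈ componentLines k := by
  have hex := hf.1
  obtain ⟨x, hx⟩ := hf.1
  have hxf : x ∈ f := hx ▸ Relation.EqvGen.refl x
  refine ⟨(highGraph μ i).connectedComponentMk ⟨x.1, hi x hxf⟩, fun y hy => ?_⟩
  have key : ∀ a b, Relation.EqvGen G.Follows a b → ∀ (ha : a ∈ f) (hb : b ∈ f),
      (highGraph μ i).connectedComponentMk ⟨a.1, hi a ha⟩ =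
        (highGraph μ i).connectedComponentMk ⟨b.1, hi b hb⟩ := fun a b hab => by
    induction hab with
    | rel a b h => exact fun ha hb => connectedComponentMk_eq_of_follows h _ _
    | refl => exact fun _ _ => rfl
    | symm _ _ _ ih => exact fun ha hb => (ih hb ha).symm
    | trans a b c h1 _ ih1 ih2 =>
      intro ha hc
      have hb := mem_of_mem_face hex ha h1
      exact (ih1 ha hb).trans (ih2 hb hc)
  rw [key x y (by rw [hx] at hy; exact hy) hxf hy]
  exact mem_componentLines_mk ⟨y.1, hi y hy⟩

lemma card_filter_faces_le [Fintype G.internalFaces] {e : G.internalFaces → G.Strand}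
    (he : ∀ f, ∀ y ∈ f.1, μ (e f).1 ≤ μ y.1) (i : ℕ) :
    (Finset.univ.filter fun f => i ≤ μ (e f).1).card ≤
      ∑ k : HighComponent μ i, G.numInternalFaces (componentLines k) := by
  have h1 : Subtype.val '' {f : G.internalFaces | i ≤ μ (e f).1} ⊆
      ⋃ k : HighComponent μ i, {f | f ∈ G.internalFaces ∧ ∀ x ∈ f, x.1 ∈ componentLines k} := by
    rintro _ ⟨f, hf, rfl⟩
    obtain ⟨k, hk⟩ := exists_component_of_face f.2 fun x hx => le_trans hf (he f x hx)
    exact Set.mem_iUnion.2 ⟨k, f.2, hk⟩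
  calc _ = (Subtype.val '' {f : G.internalFaces | i ≤ μ (e f).1}).ncard := by
        rw [Set.ncard_image_of_injective _ Subtype.val_injective, ← Set.ncard_coe_finset]
        congr 1
        ext f
        simp
    _ ≤ _ := Set.ncard_le_ncard h1 (Set.toFinite _)
    _ ≤ _ := Set.ncard_iUnion_le_of_fintype _

/-- A wave function vertex has only one field `φ`, so it determines the line that contracts it. -/
lemma phiEnd_vertex_injOn_wave :
    Set.InjOn (fun l => (G.phiEnd l).1) {l | G.kind (G.phiEnd l).1 = VertexKind.wave} := by
  intro l hl l' _ h
  refine G.phiEnd.injective (Sigma.ext h ?_)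
  have hsub : ∀ (v w : G.V) (a : Fin (G.kind v).order) (b : Fin (G.kind w).order),
      v = w → G.kind v = VertexKind.wave → a ≍ b := by
    rintro v _ a b rfl hv
    have : Subsingleton (Fin (G.kind v).order) := by
      rw [hv]; exact inferInstanceAs (Subsingleton (Fin 1))
    exact heq_of_eq (Subsingleton.elim a b)
  exact hsub _ _ _ _ h hl

-- Only an inequality: `V'_2` also counts vertices reached through their `φ̄` alone, where no high
-- propagator is differentiated.
open Classical in
lemma card_filter_wave_le (μ : G.Line → ℕ) (i : ℕ) :
    (Finset.univ.filter
      fun l : {l // G.kind (G.phiEnd l).1 = VertexKind.wave} => i ≤ μ l.1).card ≤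
      ∑ k : HighComponent μ i, G.numWave (componentLines k) := by
  set A : Set {l // G.kind (G.phiEnd l).1 = VertexKind.wave} := {l | i ≤ μ l.1} with hA
  have hinj : Function.Injective
      fun l : {l // G.kind (G.phiEnd l).1 = VertexKind.wave} => (G.phiEnd l.1).1 :=
    phiEnd_vertex_injOn_wave.injective
  have h1 : (fun l : {l // G.kind (G.phiEnd l).1 = VertexKind.wave} => (G.phiEnd l.1).1) '' A ⊆
      ⋃ k : HighComponent μ i,
        {v | G.kind v = VertexKind.wave ∧ ∃ l ∈ componentLines k, G.Incident l v} := by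
    rintro _ ⟨l, hl, rfl⟩
    exact Set.mem_iUnion.2 ⟨(highGraph μ i).connectedComponentMk ⟨l.1, hl⟩, l.2, l.1,
      mem_componentLines_mk ⟨l.1, hl⟩, Or.inl rfl⟩
  calc _ = A.ncard := by
        rw [← Set.ncard_coe_finset]
        congr 1
        ext f
        simp [hA]
    _ = _ := (Set.ncard_image_of_injective _ hinj).symm
    _ ≤ _ := Set.ncard_le_ncard h1 (Set.toFinite _)
    _ ≤ _ := Set.ncard_iUnion_le_of_fintype _

open Classical in
/-- The sum of the degrees of divergence of all high subgraphs, bounded from below in terms of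
the scales of the lines. -/
lemma le_sum_omegaD [Fintype G.internalFaces] {Λ : ℕ} (hμ : ∀ l, μ l ≤ Λ)
    {e : G.internalFaces → G.Strand} (he : ∀ f, ∀ y ∈ f.1, μ (e f).1 ≤ μ y.1) :
    (∑ f, (μ (e f).1 : ℤ)) +
        2 * ∑ l : {l // G.kind (G.phiEnd l).1 = VertexKind.wave}, (μ l.1 : ℤ) -
        2 * ∑ l, (μ l : ℤ) ≤
      2 * (Fintype.card G.Line : ℤ) + ∑ i ∈ Finset.range (Λ + 1),
        ∑ k : HighComponent μ i, G.omegaD (componentLines k) := by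
  have hL : (∑ i ∈ Finset.range (Λ + 1), ∑ k : HighComponent μ i,
      (G.numLines (componentLines k) : ℤ)) = ∑ l, ((μ l : ℤ) + 1) := by
    have := sum_range_card_filter_le hμ
    simp_rw [← sum_numLines] at this
    exact_mod_cast this
  have hF : ∑ f, ((μ (e f).1 : ℤ) + 1) ≤ ∑ i ∈ Finset.range (Λ + 1), ∑ k : HighComponent μ i,
      (G.numInternalFaces (componentLines k) : ℤ) := by
    have h1 := sum_range_card_filter_le (fun f => hμ (e f).1)
    have h2 := Finset.sum_le_sum fun i (_ : i ∈ Finset.range (Λ + 1)) =>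
      card_filter_faces_le he i
    rw [h1] at h2
    exact_mod_cast h2
  have hW : ∑ l : {l // G.kind (G.phiEnd l).1 = VertexKind.wave}, ((μ l.1 : ℤ) + 1) ≤
      ∑ i ∈ Finset.range (Λ + 1), ∑ k : HighComponent μ i,
      (G.numWave (componentLines k) : ℤ) := by
    have h1 := sum_range_card_filter_le
      (fun l : {l // G.kind (G.phiEnd l).1 = VertexKind.wave} => hμ l.1)
    have h2 := Finset.sum_le_sum fun i (_ : i ∈ Finset.range (Λ + 1)) =>
      card_filter_wave_le μ i
    rw [h1] at h2
    exact_mod_cast h2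
  -- Every count is a scale plus one. The extra ones of faces and wave function vertices have the
  -- favourable sign and are dropped; those of the lines produce the term `2 * Fintype.card G.Line`.
  simp only [omegaD, Finset.sum_add_distrib, ← Finset.mul_sum, hL]
  simp only [Finset.sum_add_distrib, Finset.sum_const, Finset.card_univ, nsmul_eq_mul,
    mul_one] at hF hW ⊢
  linarith [Int.natCast_nonneg (Fintype.card G.internalFaces),
    Int.natCast_nonneg (Fintype.card {l // G.kind (G.phiEnd l).1 = VertexKind.wave})]

/-! ### Numbers of fields and lines in terms of vertices -/

lemma order_le_three (k : VertexKind) : k.order ≤ 3 := by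
  cases k <;> simp [VertexKind.order]

lemma card_field_le : Fintype.card G.Field ≤ 3 * Fintype.card G.V := by
  rw [Fintype.card_sigma]
  simp only [Fintype.card_fin]
  calc ∑ v, (G.kind v).order ≤ ∑ _v : G.V, 3 := Finset.sum_le_sum fun v _ => order_le_three _
    _ = _ := by simp [mul_comm]

lemma card_line_le : Fintype.card G.Line ≤ 3 * Fintype.card G.V :=
  (Fintype.card_le_of_embedding G.phiEnd).trans card_field_le

end FeynmanGraph

end TensorField

namespace TensorField

open MeasureTheory

/-! ## The Laplacian of a smooth function -/

lemma ContDiff.exists_partial {F : (Fin 4 → ℝ) → ℂ} (hF : ContDiff ℝ ∞ F) (s : Fin 4) :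
    ∃ F' : (Fin 4 → ℝ) → ℂ, ContDiff ℝ ∞ F' ∧
      ∀ x t, HasDerivAt (fun t => F (Function.update x s t)) (F' (Function.update x s t)) t := by
  refine ⟨fun x => fderiv ℝ F x (Pi.single s 1),
    (hF.fderiv_right (m := ∞) le_rfl).clm_apply contDiff_const, fun x t => ?_⟩
  exact ((hF.differentiable (by simp)) _).hasFDerivAt.comp_hasDerivAt t (hasDerivAt_update x s t)

/-- Needed for the measurability of the integrand when a wave function vertex differentiates a test
function. -/
lemma continuous_laplacian {F : (Fin 4 → ℝ) → ℂ} (hF : ContDiff ℝ ∞ F) :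
    Continuous (laplacian F) := by
  unfold laplacian
  refine continuous_finsetSum _ fun s _ => ?_
  obtain ⟨F', hF', h1⟩ := ContDiff.exists_partial hF s
  obtain ⟨F'', hF'', h2⟩ := ContDiff.exists_partial hF' s
  have h : (fun x => iteratedDeriv 2 (fun t : ℝ => F (Function.update x s t)) (x s)) = F'' := by
    ext x
    rw [iteratedDeriv_succ, iteratedDeriv_one, funext fun t => (h1 x t).deriv, (h2 x _).deriv,
      Function.update_eq_self]
  rw [h]
  exact hF''.continuous

lemma prod_zpow_eq_zpow_sum {ι : Type*} {M : ℝ} (hM : M ≠ 0) (s : Finset ι) (z : ι → ℤ) :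
    ∏ a ∈ s, M ^ z a = M ^ ∑ a ∈ s, z a := by
  classical
  induction s using Finset.induction_on with
  | empty => simp
  | insert a s ha ih => rw [Finset.prod_insert ha, Finset.sum_insert ha, ih, zpow_add₀ hM]

namespace FeynmanGraph

variable {G : FeynmanGraph}

lemma dress_of_wave {a : G.Field} (h : G.kind a.1 = VertexKind.wave) (F : (Fin 4 → ℝ) → ℂ) :
    dress a F = fun x => -laplacian F x := by
  unfold dress
  rw [h]

lemma dress_of_not_wave {a : G.Field} (h : G.kind a.1 ≠ VertexKind.wave)
    (F : (Fin 4 → ℝ) → ℂ) : dress a F = F := by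
  unfold dress
  split
  · contradiction
  · rfl

/-! ## Bounds on the factors of the integrand -/

lemma sliceKernel_eq_kern_fun {M : ℝ} (hM : 1 < M) (m : ℝ) (i : ℕ) (y : Fin 4 → ℝ) :
    (fun x => ((sliceKernel M m i x y : ℝ) : ℂ)) = fun x => ((kern M m i 0 (x - y) : ℝ) : ℂ) := by
  ext x
  rw [sliceKernel_eq_kern hM]

@[fun_prop]
lemma measurable_argPhi (a : G.Field) : Measurable fun θ : G.Angles => argPhi θ a :=
  measurable_pi_lambda _ fun _ => measurable_pi_apply _

@[fun_prop]
lemma measurable_argPhibar (b : G.Field) : Measurable fun θ : G.Angles => argPhibar θ b :=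
  measurable_pi_lambda _ fun _ => measurable_pi_apply _

lemma lineFactor_of_wave {M m : ℝ} (hM : 1 < M) (hm : 0 < m) (μ : G.Line → ℕ) (θ : G.Angles)
    {l : G.Line} (h : G.kind (G.phiEnd l).1 = VertexKind.wave) :
    lineFactor M m μ θ l = -((∑ s, kern M m (μ l) (Function.update 0 s 2)
      (argPhi θ (G.phiEnd l) - argPhibar θ (G.phibarEnd l)) : ℝ) : ℂ) := by
  rw [lineFactor, dress_of_wave h, sliceKernel_eq_kern_fun hM]
  exact congrArg Neg.neg (laplacian_kern hM hm _ _ _)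

lemma lineFactor_of_not_wave {M m : ℝ} (hM : 1 < M) (μ : G.Line → ℕ) (θ : G.Angles)
    {l : G.Line} (h : G.kind (G.phiEnd l).1 ≠ VertexKind.wave) :
    lineFactor M m μ θ l =
      ((kern M m (μ l) 0 (argPhi θ (G.phiEnd l) - argPhibar θ (G.phibarEnd l)) : ℝ) : ℂ) := by
  rw [lineFactor, dress_of_not_wave h, sliceKernel_eq_kern hM]

lemma measurable_lineFactor {M m : ℝ} (hM : 1 < M) (hm : 0 < m) (μ : G.Line → ℕ) (l : G.Line) :
    Measurable fun θ : G.Angles => lineFactor M m μ θ l := by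
  by_cases h : G.kind (G.phiEnd l).1 = VertexKind.wave
  · simp_rw [lineFactor_of_wave hM hm μ _ h]
    refine (Complex.measurable_ofReal.comp (Finset.measurable_sum _ fun s _ => ?_)).neg
    exact (measurable_kern M m (μ l) _).comp (by fun_prop)
  · simp_rw [lineFactor_of_not_wave hM μ _ h]
    exact Complex.measurable_ofReal.comp ((measurable_kern M m (μ l) _).comp (by fun_prop))

lemma measurable_dress_testFunction (a b : G.Field) (f : TestFunction) :
    Measurable fun θ : G.Angles => dress a f.toFun (argPhi θ b) := by
  by_cases h : G.kind a.1 = VertexKind.wave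
  · rw [dress_of_wave h]
    exact (continuous_laplacian f.smooth).measurable.neg.comp (measurable_argPhi b)
  · rw [dress_of_not_wave h]
    exact f.smooth.continuous.measurable.comp (measurable_argPhi b)

lemma measurable_integrand {M m : ℝ} (hM : 1 < M) (hm : 0 < m) (μ : G.Line → ℕ)
    (f : G.ExtPhi → TestFunction) (fbar : G.ExtPhibar → TestFunction) :
    Measurable (integrand M m μ f fbar) := by
  unfold integrand
  refine ((Finset.measurable_prod _ fun l _ => measurable_lineFactor hM hm μ l).mul
    (Finset.measurable_prod _ fun a _ => measurable_dress_testFunction _ _ _)).mul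
    (Finset.measurable_prod _ fun b _ => ?_)
  exact (fbar b).smooth.continuous.measurable.comp (measurable_argPhibar _)

lemma norm_dress_le {B : ℝ} {f : TestFunction} (hf : f.BoundedBy B) (a : G.Field)
    (x : Fin 4 → ℝ) : ‖dress a f.toFun x‖ ≤ B := by
  by_cases h : G.kind a.1 = VertexKind.wave
  · rw [dress_of_wave h, norm_neg]
    exact (hf x).2
  · rw [dress_of_not_wave h]
    exact (hf x).1

open Classical in
/-- The growth of a propagator at coinciding points: two powers of `M` for each scale, and two
more if a Laplacian acts on it. -/
noncomputable def lineWeight (M : ℝ) (μ : G.Line → ℕ) (l : G.Line) : ℝ :=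
  M ^ (2 * μ l) * if G.kind (G.phiEnd l).1 = VertexKind.wave then M ^ (2 * μ l) else 1

lemma norm_lineFactor_le {M m C : ℝ} (hM : 1 < M) (hm : 0 < m)
    (hC : ∀ (i : ℕ) (z : Fin 4 → ℝ),
      |kern M m i 0 z| ≤ C * M ^ (2 * i) * ∏ s, strandBound M i (z s) ∧
      |∑ s, kern M m i (Function.update 0 s 2) z| ≤
        C * M ^ (4 * i) * ∏ s, strandBound M i (z s))
    (μ : G.Line → ℕ) (θ : G.Angles) (l : G.Line) :
    ‖lineFactor M m μ θ l‖ ≤ C * lineWeight M μ l *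
      ∏ s : Fin 4, strandBound M (μ l) (θ (head (l, s)) - θ (tail (l, s))) := by
  by_cases h : G.kind (G.phiEnd l).1 = VertexKind.wave
  · rw [lineFactor_of_wave hM hm μ θ h, norm_neg, Complex.norm_real, Real.norm_eq_abs]
    refine ((hC _ _).2).trans (le_of_eq ?_)
    rw [lineWeight, if_pos h, ← pow_add, show 2 * μ l + 2 * μ l = 4 * μ l by ring]
    -- The difference of the two arguments in strand `s` is by definition `θ (head (l, s)) - θ (tail
    -- (l, s))`.
    rfl
  · rw [lineFactor_of_not_wave hM μ θ h, Complex.norm_real, Real.norm_eq_abs]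
    refine ((hC _ _).1).trans (le_of_eq ?_)
    rw [lineWeight, if_neg h, mul_one]
    rfl

lemma lineWeight_nonneg {M : ℝ} (hM : 1 < M) (μ : G.Line → ℕ) (l : G.Line) :
    0 ≤ lineWeight M μ l := by
  unfold lineWeight
  split_ifs <;> positivity

lemma prod_le_pow_of_le {ι : Type*} [Fintype ι] {a : ι → ℝ} {b : ℝ} {N : ℕ}
    (h0 : ∀ x, 0 ≤ a x) (h : ∀ x, a x ≤ b) (hb : 1 ≤ b) (hN : Fintype.card ι ≤ N) :
    ∏ x, a x ≤ b ^ N := by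
  refine (Finset.prod_le_prod (fun x _ => h0 x) fun x _ => h x).trans ?_
  rw [Finset.prod_const]
  exact pow_le_pow_right₀ hb hN

lemma norm_integrand_le {M m C B : ℝ} (hM : 1 < M) (hm : 0 < m) (hC1 : 1 ≤ C)
    (hC : ∀ (i : ℕ) (z : Fin 4 → ℝ),
      |kern M m i 0 z| ≤ C * M ^ (2 * i) * ∏ s, strandBound M i (z s) ∧
      |∑ s, kern M m i (Function.update 0 s 2) z| ≤
        C * M ^ (4 * i) * ∏ s, strandBound M i (z s))
    (μ : G.Line → ℕ) {f : G.ExtPhi → TestFunction} {fbar : G.ExtPhibar → TestFunction}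
    (hf : ∀ a, (f a).BoundedBy B) (hfbar : ∀ b, (fbar b).BoundedBy B) (θ : G.Angles) :
    ‖integrand M m μ f fbar θ‖ ≤
      C ^ (3 * Fintype.card G.V) * (∏ l, lineWeight M μ l) *
        (∏ x : G.Strand, strandBound M (μ x.1) (θ (head x) - θ (tail x))) *
        (|B| + 1) ^ (6 * Fintype.card G.V) := by
  classical
  -- A base of at least one allows the exponent to be raised to the maximal number of legs, `3n` for
  -- `φ` and `3n` for `φ̄`.
  have hB : 1 ≤ |B| + 1 := by linarith [abs_nonneg B]
  have hBB : B ≤ |B| + 1 := by linarith [le_abs_self B]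
  have hcard : ∀ (p : G.Field → Prop) [Fintype {a // p a}],
      Fintype.card {a // p a} ≤ 3 * Fintype.card G.V := fun p _ =>
    (Fintype.card_le_of_injective _ Subtype.val_injective).trans card_field_le
  have hQ0 : 0 ≤ ∏ x : G.Strand, strandBound M (μ x.1) (θ (head x) - θ (tail x)) :=
    Finset.prod_nonneg fun _ _ => strandBound_nonneg _ _ _
  have hW0 : 0 ≤ ∏ l, lineWeight M μ l := Finset.prod_nonneg fun l _ => lineWeight_nonneg hM μ l
  have h1 : ∏ l, ‖lineFactor M m μ θ l‖ ≤ C ^ (3 * Fintype.card G.V) * (∏ l, lineWeight M μ l) *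
      ∏ x : G.Strand, strandBound M (μ x.1) (θ (head x) - θ (tail x)) := by
    refine (Finset.prod_le_prod (fun _ _ => norm_nonneg _)
      fun l _ => norm_lineFactor_le hM hm hC μ θ l).trans ?_
    rw [Finset.prod_mul_distrib, Finset.prod_mul_distrib, ← Fintype.prod_prod_type'
      (f := fun l s => strandBound M (μ l) (θ (head (l, s)) - θ (tail (l, s)))),
      Finset.prod_const, Finset.card_univ]
    gcongr
    exact card_line_le
  unfold integrand
  rw [norm_mul, norm_mul, norm_prod, norm_prod, norm_prod, mul_assoc,
    show 6 * Fintype.card G.V = 3 * Fintype.card G.V + 3 * Fintype.card G.V by ring, pow_add]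
  refine mul_le_mul h1 (mul_le_mul ?_ ?_ ?_ ?_) ?_ ?_
  · exact prod_le_pow_of_le (fun _ => norm_nonneg _)
      (fun a => (norm_dress_le (hf a) _ _).trans hBB) hB
      (hcard fun a => a ∉ Set.range G.phiEnd)
  · exact prod_le_pow_of_le (fun _ => norm_nonneg _)
      (fun b => ((hfbar b _).1).trans hBB) hB
      (hcard fun a => a ∉ Set.range G.phibarEnd)
  · exact Finset.prod_nonneg fun _ _ => norm_nonneg _
  · positivity
  · exact mul_nonneg (Finset.prod_nonneg fun _ _ => norm_nonneg _)
      (Finset.prod_nonneg fun _ _ => norm_nonneg _)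
  · positivity

/-! ## The power counting estimate -/

lemma prod_filter_notMem_range_mul {ι κ : Type*} [Fintype ι] [Fintype κ] {e : κ → ι}
    (he : Function.Injective e) [DecidablePred fun x => x ∉ Set.range e] (a : ι → ℝ) :
    (∏ x ∈ Finset.univ.filter (fun x => x ∉ Set.range e), a x) * ∏ k, a (e k) = ∏ x, a x := by
  classical
  rw [mul_comm, ← Finset.prod_filter_mul_prod_filter_not Finset.univ (fun x => x ∈ Set.range e) a]
  congr 1
  rw [← Finset.prod_image (g := e) (s := Finset.univ) (f := a) he.injOn]
  refine Finset.prod_congr ?_ fun _ _ => rfl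
  ext x
  simp

lemma prod_lineWeight {M : ℝ} (hM : 1 < M) (μ : G.Line → ℕ)
    [Fintype {l // G.kind (G.phiEnd l).1 = VertexKind.wave}] :
    ∏ l, lineWeight M μ l = M ^ (2 * ∑ l, (μ l : ℤ) +
      2 * ∑ l : {l // G.kind (G.phiEnd l).1 = VertexKind.wave}, (μ l.1 : ℤ)) := by
  classical
  have hM0 : M ≠ 0 := by positivity
  unfold lineWeight
  rw [Finset.prod_mul_distrib, zpow_add₀ hM0, Finset.mul_sum, Finset.mul_sum,
    ← prod_zpow_eq_zpow_sum hM0, ← prod_zpow_eq_zpow_sum hM0]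
  refine congrArg₂ (· * ·) ?_ ?_
  · exact Finset.prod_congr rfl fun l _ => by rw [← zpow_natCast]; push_cast; rfl
  · rw [← Finset.prod_filter, Finset.prod_subtype (p := fun l =>
      G.kind (G.phiEnd l).1 = VertexKind.wave) _ (by simp)]
    exact Finset.prod_congr rfl fun l _ => by rw [← zpow_natCast]; push_cast; rfl

lemma prod_strand_inv {M : ℝ} (hM : 1 < M) (μ : G.Line → ℕ) :
    ∏ x : G.Strand, (M ^ μ x.1)⁻¹ = M ^ (-4 * ∑ l, (μ l : ℤ)) := by
  have hM0 : M ≠ 0 := by positivity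
  rw [Fintype.prod_prod_type, Finset.mul_sum, ← prod_zpow_eq_zpow_sum hM0]
  refine Finset.prod_congr rfl fun l _ => ?_
  simp only [Finset.prod_const, Finset.card_univ, Fintype.card_fin]
  rw [neg_mul, zpow_neg, inv_pow, ← pow_mul, ← zpow_natCast]
  congr 2
  push_cast
  ring

lemma card_internalFaces_le [Fintype G.internalFaces] {e : G.internalFaces → G.Strand}
    (he : Function.Injective e) : Fintype.card G.internalFaces ≤ 12 * Fintype.card G.V := by
  refine (Fintype.card_le_of_injective e he).trans ?_
  have := card_line_le (G := G)
  rw [Fintype.card_prod, Fintype.card_fin]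
  omega

-- Removing one representative per closed face opens every circuit, so the forest estimate applies
-- and each remaining strand contributes its full gain.
open Classical in
lemma lintegral_strands_le {M : ℝ} (hM : 1 < M) (μ : G.Line → ℕ)
    {e : G.internalFaces → G.Strand} (he : ∀ f, e f ∈ f.1) :
    ∫⁻ θ, ENNReal.ofReal (∏ x ∈ Finset.univ.filter (fun x : G.Strand => x ∉ Set.range e),
        strandBound M (μ x.1) (θ (head x) - θ (tail x))) ∂G.haarAngles ≤
      ENNReal.ofReal (∏ x ∈ Finset.univ.filter (fun x : G.Strand => x ∉ Set.range e),
        (M ^ μ x.1)⁻¹) := by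
  rw [ENNReal.ofReal_prod_of_nonneg fun x _ => by positivity]
  simp_rw [ENNReal.ofReal_prod_of_nonneg fun x _ => strandBound_nonneg _ _ _]
  refine lintegral_prod_forest_le head_injective haarAngle
    (g := fun x t => ENNReal.ofReal (strandBound M (μ x.1) t))
    (fun x => (measurable_strandBound M _).ennreal_ofReal)
    (fun x y => lintegral_strandBound_le hM _ y) _ fun T hT hne => ?_
  refine exists_terminal (S := {x | x ∉ Set.range e})
    (fun f hf => ⟨e ⟨f, hf⟩, he ⟨f, hf⟩, fun h => h ⟨_, rfl⟩⟩) T (fun x hx => ?_) hne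
  simpa using hT hx

open Classical in
lemma lintegral_integrand_le {M m C B : ℝ} (hM : 1 < M) (hm : 0 < m) (hC1 : 1 ≤ C)
    (hC : ∀ (i : ℕ) (z : Fin 4 → ℝ),
      |kern M m i 0 z| ≤ C * M ^ (2 * i) * ∏ s, strandBound M i (z s) ∧
      |∑ s, kern M m i (Function.update 0 s 2) z| ≤
        C * M ^ (4 * i) * ∏ s, strandBound M i (z s))
    {Λ : ℕ} {μ : G.Line → ℕ} (hμ : ∀ l, μ l ≤ Λ)
    {f : G.ExtPhi → TestFunction} {fbar : G.ExtPhibar → TestFunction}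
    (hf : ∀ a, (f a).BoundedBy B) (hfbar : ∀ b, (fbar b).BoundedBy B) :
    ∫⁻ θ, ‖integrand M m μ f fbar θ‖ₑ ∂G.haarAngles ≤
      ENNReal.ofReal ((C ^ 3 * (3 * thetaConst) ^ 12 * (|B| + 1) ^ 6 * M ^ 6) ^ Fintype.card G.V *
        ∏ i ∈ Finset.range (Λ + 1), ∏ k : HighComponent μ i, M ^ G.omegaD (componentLines k)) := by
  have hM0 : M ≠ 0 := by positivity
  have hθ := one_le_thetaConst
  -- Bounding a strand pointwise forfeits its gain `M^(-μ)`. The strand of minimal scale costs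
  -- least, and its scale is the last level at which the face lies in a high subgraph.
  choose e hef hemin using exists_min_strand (G := G) μ
  have hinj : Function.Injective e := fun f f' h => Subtype.ext <| by
    rw [eq_faceOf_of_mem f.2.1 (hef f), eq_faceOf_of_mem f'.2.1 (hef f'), h]
  set n := Fintype.card G.V with hn
  set S := Finset.univ.filter (fun x : G.Strand => x ∉ Set.range e) with hS
  set D := C ^ (3 * n) * (∏ l, lineWeight M μ l) * (3 * thetaConst) ^ (12 * n) *
    (|B| + 1) ^ (6 * n) with hD
  have hD0 : 0 ≤ D := by
    have : 0 ≤ ∏ l, lineWeight M μ l := Finset.prod_nonneg fun l _ => lineWeight_nonneg hM μ l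
    positivity
  have hpoint : ∀ θ : G.Angles, ‖integrand M m μ f fbar θ‖ₑ ≤ ENNReal.ofReal D *
      ENNReal.ofReal (∏ x ∈ S, strandBound M (μ x.1) (θ (head x) - θ (tail x))) := fun θ => by
    rw [← ENNReal.ofReal_mul hD0, ← ofReal_norm]
    refine ENNReal.ofReal_le_ofReal ((norm_integrand_le hM hm hC1 hC μ hf hfbar θ).trans ?_)
    rw [← prod_filter_notMem_range_mul hinj]
    have hfaces : ∏ k, strandBound M (μ (e k).1) (θ (head (e k)) - θ (tail (e k))) ≤
        (3 * thetaConst) ^ (12 * n) :=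
      prod_le_pow_of_le (fun _ => strandBound_nonneg _ _ _) (fun _ => strandBound_le hM _ _)
        (by linarith) (card_internalFaces_le hinj)
    have hP0 : 0 ≤ ∏ x ∈ S, strandBound M (μ x.1) (θ (head x) - θ (tail x)) :=
      Finset.prod_nonneg fun _ _ => strandBound_nonneg _ _ _
    have hW0 : 0 ≤ ∏ l, lineWeight M μ l := Finset.prod_nonneg fun l _ => lineWeight_nonneg hM μ l
    calc _ ≤ C ^ (3 * n) * (∏ l, lineWeight M μ l) *
          ((∏ x ∈ S, strandBound M (μ x.1) (θ (head x) - θ (tail x))) *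
            (3 * thetaConst) ^ (12 * n)) * (|B| + 1) ^ (6 * n) := by gcongr
      _ = _ := by rw [hD]; ring
  refine (lintegral_mono hpoint).trans ?_
  rw [lintegral_const_mul' _ _ ENNReal.ofReal_ne_top]
  refine (mul_le_mul_right (lintegral_strands_le hM μ hef) _).trans ?_
  rw [← ENNReal.ofReal_mul hD0]
  refine ENNReal.ofReal_le_ofReal ?_
  -- All strands together would give `-4 Σ μ_l`, four per line; the scales of the removed strands
  -- are added back.
  have hprodS : ∏ x ∈ S, (M ^ μ x.1)⁻¹ =
      M ^ (-4 * ∑ l, (μ l : ℤ) + ∑ f, (μ (e f).1 : ℤ)) := by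
    have h := prod_filter_notMem_range_mul hinj fun x => (M ^ μ x.1)⁻¹
    rw [prod_strand_inv hM] at h
    have hone : (∏ f, (M ^ μ (e f).1)⁻¹) * ∏ f, M ^ (μ (e f).1 : ℤ) = 1 := by
      rw [← Finset.prod_mul_distrib]
      refine Finset.prod_eq_one fun f _ => ?_
      rw [zpow_natCast]
      exact inv_mul_cancel₀ (by positivity)
    rw [zpow_add₀ hM0, ← h, ← prod_zpow_eq_zpow_sum hM0, mul_assoc, hone, mul_one]
  have homega : ∏ i ∈ Finset.range (Λ + 1), ∏ k : HighComponent μ i,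
      M ^ G.omegaD (componentLines k) = M ^ ∑ i ∈ Finset.range (Λ + 1),
        ∑ k : HighComponent μ i, G.omegaD (componentLines k) := by
    rw [← prod_zpow_eq_zpow_sum hM0]
    exact Finset.prod_congr rfl fun i _ => prod_zpow_eq_zpow_sum hM0 _ _
  have hexp := le_sum_omegaD hμ hemin
  have hL := card_line_le (G := G)
  set Ω := ∑ i ∈ Finset.range (Λ + 1), ∑ k : HighComponent μ i, G.omegaD (componentLines k)
  -- The exponent is at most `Ω` plus twice the number of lines, and there are at most `3n` lines.
  have hpow : (∏ l, lineWeight M μ l) * ∏ x ∈ S, (M ^ μ x.1)⁻¹ ≤ M ^ (6 * n) * M ^ Ω := by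
    rw [prod_lineWeight hM, hprodS, ← zpow_add₀ hM0, ← zpow_natCast M (6 * n), ← zpow_add₀ hM0]
    refine zpow_le_zpow_right₀ hM.le ?_
    have hL' : (Fintype.card G.Line : ℤ) ≤ 3 * (n : ℤ) := by exact_mod_cast hL
    push_cast
    linarith
  rw [homega]
  calc D * ∏ x ∈ S, (M ^ μ x.1)⁻¹
      = C ^ (3 * n) * (3 * thetaConst) ^ (12 * n) * (|B| + 1) ^ (6 * n) *
        ((∏ l, lineWeight M μ l) * ∏ x ∈ S, (M ^ μ x.1)⁻¹) := by rw [hD]; ring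
    _ ≤ C ^ (3 * n) * (3 * thetaConst) ^ (12 * n) * (|B| + 1) ^ (6 * n) *
        (M ^ (6 * n) * M ^ Ω) := by gcongr
    _ = _ := by simp only [mul_pow, ← pow_mul]; ring

end FeynmanGraph

end TensorField

theorem lemma2 (M m B : ℝ) (hM : 1 < M) (hm : 0 < m) :
    ∃ K : ℝ, 0 < K ∧
      ∀ (G : TensorField.FeynmanGraph), G.IsConnected →
      ∀ (Λ : ℕ) (μ : G.Line → ℕ), (∀ l, μ l ≤ Λ) →
      ∀ (f : G.ExtPhi → TensorField.TestFunction)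
        (fbar : G.ExtPhibar → TensorField.TestFunction),
        (∀ a, (f a).BoundedBy B) → (∀ b, (fbar b).BoundedBy B) →
        MeasureTheory.Integrable
            (TensorField.FeynmanGraph.integrand M m μ f fbar) G.haarAngles ∧
          ‖TensorField.FeynmanGraph.amplitude M m μ f fbar‖ ≤
            K ^ Fintype.card G.V *
              ∏ i ∈ Finset.range (Λ + 1),
                ∏ k : TensorField.FeynmanGraph.HighComponent μ i,
                  M ^ G.omegaD (TensorField.FeynmanGraph.componentLines k) := by
  obtain ⟨C, hC1, hC⟩ := TensorField.exists_kern_bound hM hm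
  have hθ := TensorField.one_le_thetaConst
  have hK : 0 < C ^ 3 * (3 * TensorField.thetaConst) ^ 12 * (|B| + 1) ^ 6 * M ^ 6 := by positivity
  refine ⟨_, hK, fun G _ Λ μ hμ f fbar hf hfbar => ?_⟩
  -- The bound is on the integral of the norm, so it yields integrability as well as the estimate.
  have hle := TensorField.FeynmanGraph.lintegral_integrand_le hM hm hC1 hC hμ hf hfbar
  refine ⟨⟨(TensorField.FeynmanGraph.measurable_integrand hM hm μ f fbar).aestronglyMeasurable,
    hle.trans_lt ENNReal.ofReal_lt_top⟩, ?_⟩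
  rw [← ENNReal.ofReal_le_ofReal_iff, ofReal_norm]
  · exact (MeasureTheory.enorm_integral_le_lintegral_enorm _).trans hle
  · exact mul_nonneg (pow_nonneg hK.le _) (Finset.prod_nonneg fun i _ =>
      Finset.prod_nonneg fun k _ => by positivity)
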